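/- Consider randomized adaptive algorithms that are given an integer $n$ and oracle access to an unknown simple undirected graph $G=(V,E)$ with $|V|=n$ vertices (labelled by $\{0,\dots,n-1\}$), none of them isolated. Let $d=\frac1n\sum_{v\in V}\deg(v)$ denote the average degree of $G$. For $c\ge 1$, a $c$-approximation to $d$ is a real number $x$ with $d/c\le x\le c\,d$. The oracles, each of unit cost per query, are: $\mathbf{RandVert}()$, which returns a uniformly random vertex; $\mathbf{RandEdge}()$, which returns a uniformly random edge; $\mathbf{RandNbr}(x)$, which returns a uniformly random neighbor of the vertex $x$; $\mathbf{Degree}(x)$, which returns $\deg(x)$; $\mathbf{Pair}(x,y)$, which tells whether $\{x,y\}\in E$; and $\mathbf{FullNbrHood}(x)$, which returns the set of all neighbors of $x$. All random answers are independent. The computation between the queries is not charged. For a set of oracles and an exponent $r>0$, say that $\Omega(n^{r})$ queries are needed if for every constant $c\ge 1$ there are $\varepsilon>0$ and $N$ such that the following holds for all $n\ge N$ and every natural number $q$: if some algorithm that uses only these oracles, run on any $n$-vertex graph $G$ without isolated vertices, outputs after at most $q$ queries a $c$-approximation to $d$ with probability greater than $2/3$, then $q\ge\varepsilon n^{r}$.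 Theorem. (a) With the oracles $\mathbf{RandVert}$, $\mathbf{RandNbr}$, $\mathbf{Degree}$ and $\mathbf{RandEdge}$ only, $\Omega(n^{1/3})$ queries are needed. (b) With these four oracles and $\mathbf{Pair}$, $\Omega(n^{1/4})$ queries are needed. (c) With these four oracles and $\mathbf{FullNbrHood}$, $\Omega(n^{1/5})$ queries are needed. -/

import Mathlib

namespace AvgDegree

/-- The oracle queries. -/
inductive Query (V : Type) : Type
  | randVert : Query V
  | randEdge : Query V
  | randNbr (x : V) : Query V
  | degree (x : V) : Query V
  | pair (x y : V) : Query V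
  | fullNbrHood (x : V) : Query V

/-- The possible answers of the oracles. The answer `fail` is only ever given when the set to be
sampled from is empty, which does not happen on a nonempty graph without isolated vertices. -/
inductive Answer (V : Type) : Type
  | vertex (v : V) : Answer V
  | edge (e : Sym2 V) : Answer V
  | number (k : ℕ) : Answer V
  | bit (b : Bool) : Answer V
  | vertices (S : Finset V) : Answer V
  | fail : Answer V

/-- The queries `RandVert`, `RandEdge`, `RandNbr(x)` and `Degree(x)`. -/
def baseQueries (V : Type) : Set (Query V) :=
  {Query.randVert, Query.randEdge} ∪ Set.range Query.randNbr ∪ Set.range Query.degree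

/-- `baseQueries` together with `Pair(x, y)`. -/
def pairQueries (V : Type) : Set (Query V) :=
  baseQueries V ∪ {q | ∃ x y, q = Query.pair x y}

/-- `baseQueries` together with `FullNbrHood(x)`. -/
def fullQueries (V : Type) : Set (Query V) :=
  baseQueries V ∪ Set.range Query.fullNbrHood

/-- The answer `f a`, for `a` uniformly distributed in `s`. -/
noncomputable def uniformAnswer {V α : Type} (s : Finset α) (f : α → Answer V) :
    PMF (Answer V) :=
  open scoped Classical in
  if hs : s.Nonempty then (PMF.uniformOfFinset s hs).map f else PMF.pure Answer.fail

open scoped Classical in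
/-- The distribution of the answer to a query on the graph `G`. -/
noncomputable def respond {V : Type} [Fintype V] (G : SimpleGraph V) :
    Query V → PMF (Answer V)
  | Query.randVert => uniformAnswer Finset.univ Answer.vertex
  | Query.randEdge => uniformAnswer G.edgeFinset Answer.edge
  | Query.randNbr x => uniformAnswer (G.neighborFinset x) Answer.vertex
  | Query.degree x => PMF.pure (Answer.number (G.degree x))
  | Query.pair x y => PMF.pure (Answer.bit (decide (G.Adj x y)))
  | Query.fullNbrHood x => PMF.pure (Answer.vertices (G.neighborFinset x))

/-- A randomized adaptive query algorithm on the (known) vertex set `V` which only uses queries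
in `allowed`. Given the list of all queries made so far and of the answers received (the latest
one first), it chooses at random its next step: to make an allowed query (`Sum.inl`), or to
stop and output a real number (`Sum.inr`). The computational power of the algorithm between
queries is unrestricted. -/
abbrev Algorithm (V : Type) (allowed : Set (Query V)) : Type :=
  List (Query V × Answer V) → PMF (allowed ⊕ ℝ)

/-- The distribution of the result when `A` is run on `G` from the history `h` and is permitted
to make at most `q` further queries: `some x` if `A` stops with the output `x`, and `none` if `A`
attempts to make one more query than permitted. Different oracle answers are independent. -/
noncomputable def run {V : Type} [Fintype V] {allowed : Set (Query V)} (G : SimpleGraph V)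
    (A : Algorithm V allowed) : ℕ → List (Query V × Answer V) → PMF (Option ℝ)
  | 0, h => (A h).bind (Sum.elim (fun _ => PMF.pure none) (fun x => PMF.pure (some x)))
  | q + 1, h => (A h).bind (Sum.elim
      (fun u => (respond G u).bind (fun a => run G A q ((↑u, a) :: h)))
      (fun x => PMF.pure (some x)))

open scoped Classical in
/-- The average degree of `G`. -/
noncomputable def avgDegree {V : Type} [Fintype V] (G : SimpleGraph V) : ℝ :=
  (∑ v, (G.degree v : ℝ)) / (Fintype.card V : ℝ)

/-- `x` is a `c`-approximation to `d`. -/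
def IsApprox (c d x : ℝ) : Prop := d / c ≤ x ∧ x ≤ c * d

/-- On every graph with vertex set `V` and no isolated vertices, with probability more than `2/3`,
the algorithm `A` outputs a `c`-approximation to the average degree after at most `q` queries. -/
def Estimates {V : Type} [Fintype V] {allowed : Set (Query V)} (A : Algorithm V allowed)
    (q : ℕ) (c : ℝ) : Prop :=
  ∀ G : SimpleGraph V, (∀ v, ∃ w, G.Adj v w) →
    2 / 3 < (run G A q []).toOuterMeasure {r | ∃ x, r = some x ∧ IsApprox c (avgDegree G) x}

/-- Every algorithm which uses only the queries in `allowed`, knows the number `n` of vertices and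
outputs an `O(1)`-approximation to the average degree with probability more than `2/3`
must make `Ω(n ^ r)` queries. -/
def RequiresQueries (allowed : ∀ V : Type, Set (Query V)) (r : ℝ) : Prop :=
  ∀ c : ℝ, 1 ≤ c → ∃ ε : ℝ, 0 < ε ∧ ∃ N : ℕ, ∀ n : ℕ, N ≤ n →
    ∀ (A : Algorithm (Fin n) (allowed (Fin n))) (q : ℕ), Estimates A q c → ε * (n : ℝ) ^ r ≤ q

end AvgDegree

open scoped ENNReal

namespace AvgDegree

/-! ### Weighted runs and the comparison principle -/

section WeightedRun

variable {V : Type} {allowed : Set (Query V)}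

/-! Two families of random graphs are built whose average degrees differ by more than a factor `c²`
but which few queries cannot tell apart. Take `s` disjoint blocks of vertices and, on all vertices,
a graph `M` with degrees 1 and 2. Add cliques, each with exactly one vertex in every block; which
one is decided by independent random permutations of the blocks. One family has `m` cliques, the
other `K * m` with `K ≥ 2c²`. Write `n = a^(k+3)` and, up to constants, `s = a²`, `m = a^k`, so that
blocks have size `a^(k+1)`. Then `M` carries only a fraction `O(1/a)` of the edges, and a vertex
about which nothing is known lies in a clique with probability `O(1/a)`. Hence in `q ≪ a` queries
all random edges typically lie in cliques, and clique vertices are found only from random edges and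
from clique vertices found before. What is learnt is a set of components, one for each random edge,
and the number of cliques shows only through the question which components belong to the same
clique.

How this can be found out decides `k`. With the basic queries and `q² ≪ s`, new clique vertices
almost always lie in untouched blocks, where their position says nothing about their clique; even `m
= 1` works. A pair query may compare two components, which agree with probability `1/m`, so `m ≫ q`
is needed. A full neighbourhood shows the clique in all blocks, so any two components may be
compared, and `m ≫ q²` is needed.

Instead of a coupling, likelihoods of histories are compared. The weight `ref` describes an ideal
process that does not depend on the number of cliques: each random edge opens a new component at
fresh vertices, and vertices outside the components behave as in `M`. Two facts are needed. First,
the weights of all answers to a query add up to at least `1 - 1/(20(q+1))` times the weight of the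
history (`ref_le_tsum_ref`). Second, the true likelihood, averaged over the permutations, is at
least `(19/20)³` times `ref` for both families (`pow_three_mul_ref_le_tsum_lik`): with `e` random
edges there are about `m^e` ways to assign cliques to the components, and each random edge hits a
given clique with probability about `1/m`, so `m` cancels. Every final result is wrong for one of
the families, so the two average failure probabilities have sum at least `(19/20)⁴ > 2/3`, and they
cannot both be at most `1/3` (`not_estimates_of_reference`). -/

/-- The histories of query algorithms. -/
abbrev History (V : Type) : Type := List (Query V × Answer V)

/-- The total weight of the runs of `A` which start at the history `h`, make at most `q` further
queries and have a result in `S`, where a final history `h'` counts with the weight `Λ h'` times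
the probability of the choices of `A`. -/
noncomputable def val (A : Algorithm V allowed) (S : Set (Option ℝ)) (Λ : History V → ℝ≥0∞) :
    ℕ → History V → ℝ≥0∞
  | 0, h => ∑' z, A h z * Sum.elim (fun _ => Λ h * S.indicator 1 none)
      (fun x => Λ h * S.indicator 1 (some x)) z
  | q + 1, h => ∑' z, A h z * Sum.elim (fun u : allowed => ∑' a, val A S Λ q ((↑u, a) :: h))
      (fun x => Λ h * S.indicator 1 (some x)) z

/-- The probability that the answers in a history are given by the oracles of `G`. -/
noncomputable def lik [Fintype V] (G : SimpleGraph V) : History V → ℝ≥0∞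
  | [] => 1
  | (u, a) :: h => respond G u a * lik G h

lemma pure_toOuterMeasure_indicator {α : Type} (S : Set α) (x : α) :
    (PMF.pure x).toOuterMeasure S = S.indicator 1 x := by
  classical
  rw [PMF.toOuterMeasure_pure_apply, Set.indicator_apply]
  rfl

/-- Links `val` to actual runs. Separating the weight of a history from the choices of the algorithm
makes the total additive and monotone in the weight, so likelihoods can be averaged over graphs and
bounded below by a reference. -/
lemma val_lik [Fintype V] (G : SimpleGraph V) (A : Algorithm V allowed) (S : Set (Option ℝ))
    (q : ℕ) (h : History V) :
    val A S (lik G) q h = lik G h * (run G A q h).toOuterMeasure S := by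
  induction q generalizing h with
  | zero =>
    rw [val, run, PMF.toOuterMeasure_bind_apply, ← ENNReal.tsum_mul_left]
    refine tsum_congr fun z => ?_
    rcases z with z | z <;>
      simp only [Sum.elim_inl, Sum.elim_inr, pure_toOuterMeasure_indicator] <;> ring
  | succ q ih =>
    rw [val, run, PMF.toOuterMeasure_bind_apply, ← ENNReal.tsum_mul_left]
    refine tsum_congr fun z => ?_
    rcases z with z | z
    · simp only [Sum.elim_inl, ih, lik, PMF.toOuterMeasure_bind_apply]
      rw [mul_left_comm, ← ENNReal.tsum_mul_left (a := lik G h)]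
      congr 1
      refine tsum_congr fun a => ?_
      ring
    · simp only [Sum.elim_inr, pure_toOuterMeasure_indicator]; ring

/-- The histories of length at most `q` in which only allowed queries occur. -/
def Reachable (allowed : Set (Query V)) (q : ℕ) (h : History V) : Prop :=
  h.length ≤ q ∧ ∀ p ∈ h, p.1 ∈ allowed

lemma Reachable.cons {q : ℕ} {h : History V} (u : allowed) (a : Answer V)
    (hh : h.length + 1 ≤ q) (hr : ∀ p ∈ h, p.1 ∈ allowed) :
    Reachable allowed q ((↑u, a) :: h) := by
  refine ⟨by simpa using hh, ?_⟩
  intro p hp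
  rcases List.mem_cons.1 hp with rfl | hp
  · exact u.2
  · exact hr p hp

lemma mul_val_le_val (A : Algorithm V allowed) (S : Set (Option ℝ)) {Λ Λ' : History V → ℝ≥0∞}
    {r : ℝ≥0∞} {N : ℕ} (hle : ∀ h, Reachable allowed N h → r * Λ h ≤ Λ' h) (q : ℕ)
    (h : History V) (hh : h.length + q ≤ N) (hr : ∀ p ∈ h, p.1 ∈ allowed) :
    r * val A S Λ q h ≤ val A S Λ' q h := by
  have hnow := hle h ⟨by omega, hr⟩
  induction q generalizing h with
  | zero =>
    rw [val, val, ← ENNReal.tsum_mul_left]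
    refine ENNReal.tsum_le_tsum fun z => ?_
    rw [mul_left_comm]
    gcongr
    rcases z with z | z <;>
    · simp only [Sum.elim_inl, Sum.elim_inr, ← mul_assoc]
      gcongr
  | succ q ih =>
    rw [val, val, ← ENNReal.tsum_mul_left]
    refine ENNReal.tsum_le_tsum fun z => ?_
    rw [mul_left_comm]
    gcongr
    rcases z with z | z
    · simp only [Sum.elim_inl, ← ENNReal.tsum_mul_left]
      refine ENNReal.tsum_le_tsum fun a => ?_
      have hc : Reachable allowed N ((↑z, a) :: h) := Reachable.cons z a (by omega) hr
      exact ih _ (by simp; omega) hc.2 (hle _ hc)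
    · simp only [Sum.elim_inr, ← mul_assoc]
      gcongr

lemma val_tsum (A : Algorithm V allowed) (S : Set (Option ℝ)) {Ω : Type}
    (Λ : Ω → History V → ℝ≥0∞) (q : ℕ) (h : History V) :
    val A S (fun h => ∑' ω, Λ ω h) q h = ∑' ω, val A S (Λ ω) q h := by
  induction q generalizing h with
  | zero =>
    simp only [val]
    rw [ENNReal.tsum_comm]
    refine tsum_congr fun z => ?_
    rw [ENNReal.tsum_mul_left]
    rcases z with z | z <;> simp [ENNReal.tsum_mul_right]
  | succ q ih =>
    simp only [val]
    rw [ENNReal.tsum_comm]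
    refine tsum_congr fun z => ?_
    rw [ENNReal.tsum_mul_left]
    rcases z with z | z
    · simp only [Sum.elim_inl, ih]
      rw [ENNReal.tsum_comm]
    · simp [ENNReal.tsum_mul_right]

/-- No result lies in both sets, so every final history is a failure for at least one of them. -/
lemma val_univ_le_add_compl (A : Algorithm V allowed) {S S' : Set (Option ℝ)}
    (hS : Disjoint S S') (Λ : History V → ℝ≥0∞) (q : ℕ) (h : History V) :
    val A Set.univ Λ q h ≤ val A Sᶜ Λ q h + val A S'ᶜ Λ q h := by
  have key : ∀ r : Option ℝ, (Set.univ : Set (Option ℝ)).indicator (1 : Option ℝ → ℝ≥0∞) r ≤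
      Sᶜ.indicator 1 r + S'ᶜ.indicator 1 r := by
    intro r
    by_cases hr : r ∈ S
    · have : r ∉ S' := fun h' => Set.disjoint_left.1 hS hr h'
      simp [hr, this]
    · simp [hr]
  have key' : ∀ r : Option ℝ, ∀ c : ℝ≥0∞,
      c * (Set.univ : Set (Option ℝ)).indicator (1 : Option ℝ → ℝ≥0∞) r ≤
      c * Sᶜ.indicator 1 r + c * S'ᶜ.indicator 1 r := by
    intro r c
    rw [← mul_add]
    gcongr
    exact key r
  induction q generalizing h with
  | zero =>
    rw [val, val, val, ← ENNReal.tsum_add]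
    refine ENNReal.tsum_le_tsum fun z => ?_
    rw [← mul_add]
    gcongr
    rcases z with z | z <;> exact key' _ _
  | succ q ih =>
    rw [val, val, val, ← ENNReal.tsum_add]
    refine ENNReal.tsum_le_tsum fun z => ?_
    rw [← mul_add]
    gcongr
    rcases z with z | z
    · simp only [Sum.elim_inl, ← ENNReal.tsum_add]
      exact ENNReal.tsum_le_tsum fun a => ih _
    · exact key' _ _

/-- Each query loses at most a factor `r` of the weight and the choices of the algorithm lose
nothing; a run that stops early loses less, because `r ≤ 1`. -/
lemma pow_mul_le_val_univ (A : Algorithm V allowed) {Λ : History V → ℝ≥0∞} {r : ℝ≥0∞} {N : ℕ}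
    (hr1 : r ≤ 1)
    (hle : ∀ h, Reachable allowed N h → h.length < N → ∀ u ∈ allowed,
      r * Λ h ≤ ∑' a, Λ ((u, a) :: h)) (q : ℕ)
    (h : History V) (hh : h.length + q ≤ N) (hr : ∀ p ∈ h, p.1 ∈ allowed) :
    r ^ q * Λ h ≤ val A Set.univ Λ q h := by
  induction q generalizing h with
  | zero =>
    rw [val]
    have : ∀ z, Sum.elim (fun _ : allowed => Λ h * (Set.univ : Set (Option ℝ)).indicator 1 none)
      (fun x : ℝ => Λ h * (Set.univ : Set (Option ℝ)).indicator 1 (some x)) z = Λ h := by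
      rintro (z | z) <;> simp
    simp only [this]
    rw [ENNReal.tsum_mul_right, PMF.tsum_coe]
    simp
  | succ q ih =>
    rw [val]
    calc r ^ (q + 1) * Λ h = ∑' z, A h z * (r ^ (q + 1) * Λ h) := by
          rw [ENNReal.tsum_mul_right, PMF.tsum_coe, one_mul]
      _ ≤ _ := by
          refine ENNReal.tsum_le_tsum fun z => ?_
          gcongr
          rcases z with z | z
          · simp only [Sum.elim_inl]
            calc r ^ (q + 1) * Λ h = r ^ q * (r * Λ h) := by ring
              _ ≤ r ^ q * ∑' a, Λ ((↑z, a) :: h) := by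
                gcongr
                exact hle h ⟨by omega, hr⟩ (by omega) z z.2
              _ = ∑' a, r ^ q * Λ ((↑z, a) :: h) := by rw [ENNReal.tsum_mul_left]
              _ ≤ _ := by
                refine ENNReal.tsum_le_tsum fun a => ?_
                have hc : Reachable allowed N ((↑z, a) :: h) :=
                  Reachable.cons z a (by omega) hr
                exact ih _ (by simp; omega) hc.2
          · simp only [Sum.elim_inr, Set.indicator_univ, Pi.one_apply, mul_one]
            calc r ^ (q + 1) * Λ h ≤ 1 * Λ h := by
                  gcongr
                  exact pow_le_one₀ (zero_le) hr1
              _ = Λ h := one_mul _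

lemma toOuterMeasure_compl_le {α : Type} (p : PMF α) {S : Set α}
    (h : 2 / 3 < p.toOuterMeasure S) : p.toOuterMeasure Sᶜ ≤ 1 / 3 := by
  have h1 : p.toOuterMeasure S + p.toOuterMeasure Sᶜ = 1 := by
    rw [PMF.toOuterMeasure_apply, PMF.toOuterMeasure_apply, ← ENNReal.tsum_add, ← p.tsum_coe]
    exact tsum_congr fun x => by
      by_cases hx : x ∈ S <;> simp [hx]
  by_contra hc
  push Not at hc
  have h2 := ENNReal.add_lt_add h hc
  rw [h1] at h2
  refine absurd h2 (not_lt.2 ?_)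
  rw [ENNReal.div_add_div_same]
  norm_num
  rw [ENNReal.div_self] <;> norm_num

/-- Two families of graphs on which the same reference weight `Λ` is, up to a constant factor,
a lower bound for the average probability of the histories cannot be told apart. -/
theorem not_estimates_of_reference [Fintype V] {Ω : Type} [Fintype Ω] [Nonempty Ω]
    (G G' : Ω → SimpleGraph V) (A : Algorithm V allowed) (q : ℕ) {S S' : Set (Option ℝ)}
    (hS : Disjoint S S')
    (hG : ∀ ω, 2 / 3 < (run (G ω) A q []).toOuterMeasure S)
    (hG' : ∀ ω, 2 / 3 < (run (G' ω) A q []).toOuterMeasure S')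
    (Λ : History V → ℝ≥0∞) (hΛ : Λ [] = 1) {r r' : ℝ≥0∞} (hr1 : r ≤ 1)
    (hsum : ∀ h, Reachable allowed q h → h.length < q → ∀ u ∈ allowed,
      r * Λ h ≤ ∑' a, Λ ((u, a) :: h))
    (hlik : ∀ h, Reachable allowed q h →
      r' * Fintype.card Ω * Λ h ≤ ∑' ω, lik (G ω) h)
    (hlik' : ∀ h, Reachable allowed q h →
      r' * Fintype.card Ω * Λ h ≤ ∑' ω, lik (G' ω) h) :
    r' * r ^ q ≤ 2 / 3 := by
  have main : ∀ (H : Ω → SimpleGraph V) (R : Set (Option ℝ)),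
      (∀ ω, 2 / 3 < (run (H ω) A q []).toOuterMeasure R) →
      (∀ h, Reachable allowed q h → r' * Fintype.card Ω * Λ h ≤ ∑' ω, lik (H ω) h) →
      r' * val A Rᶜ Λ q [] ≤ 1 / 3 := by
    intro H R hH hl
    have h1 := mul_val_le_val A Rᶜ hl q [] (by simp) (by simp)
    rw [val_tsum] at h1
    have h2 : ∑' ω, val A Rᶜ (lik (H ω)) q [] ≤ Fintype.card Ω * (1 / 3) := by
      calc ∑' ω, val A Rᶜ (lik (H ω)) q [] ≤ ∑' _ : Ω, (1 / 3 : ℝ≥0∞) := by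
            refine ENNReal.tsum_le_tsum fun ω => ?_
            rw [val_lik]
            simpa [lik] using toOuterMeasure_compl_le _ (hH ω)
        _ = _ := by rw [tsum_fintype]; simp
    have h3 := h1.trans h2
    rw [mul_comm r', mul_assoc] at h3
    rwa [ENNReal.mul_le_mul_iff_right (by simp) (by simp)] at h3
  have h1 := main G S hG hlik
  have h2 := main G' S' hG' hlik'
  have h3 := pow_mul_le_val_univ A hr1 hsum q [] (by simp) (by simp)
  rw [hΛ, mul_one] at h3
  calc r' * r ^ q ≤ r' * (val A Sᶜ Λ q [] + val A S'ᶜ Λ q []) := by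
        gcongr
        exact h3.trans (val_univ_le_add_compl A hS Λ q [])
    _ ≤ 1 / 3 + 1 / 3 := by rw [mul_add]; gcongr
    _ = 2 / 3 := by rw [ENNReal.div_add_div_same]; norm_num

end WeightedRun

/-! ### The hard instances: a sparse graph plus hidden cliques -/

open scoped Classical in
/-- A sparse graph `M` without isolated vertices, together with disjoint blocks of vertices,
indexed by `I`, whose members are labelled by `L`. The edges of `M` do not connect different
blocks. -/
structure Frame (V I L : Type) [Fintype V] where
  E : I × L ↪ V
  M : SimpleGraph V
  eq_of_adj : ∀ {i j l l'}, M.Adj (E (i, l)) (E (j, l')) → i = j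
  degree_pos : ∀ v, 0 < M.degree v
  degree_le : ∀ v, M.degree v ≤ 2

namespace Frame

section Graph

variable {V I L : Type} [Fintype V] (F : Frame V I L)

/-- The vertex of the colour `κ` in the block `i`, if `ω` says which labels have which colour. -/
def cl (ω : I → Equiv.Perm L) (κ : L) (i : I) : V := F.E (i, ω i κ)

lemma cl_inj {ω : I → Equiv.Perm L} {κ κ' : L} {i j : I} :
    F.cl ω κ i = F.cl ω κ' j ↔ κ = κ' ∧ i = j := by
  constructor
  · intro h
    have h1 := F.E.injective h
    simp only [Prod.mk.injEq] at h1
    obtain ⟨rfl, h2⟩ := h1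
    exact ⟨(ω i).injective h2, rfl⟩
  · rintro ⟨rfl, rfl⟩; rfl

/-- The graph `M` together with a clique on the vertices of each colour in `T`. -/
def graph (T : Finset L) (ω : I → Equiv.Perm L) : SimpleGraph V where
  Adj x y := F.M.Adj x y ∨ ∃ κ ∈ T, ∃ i j, i ≠ j ∧ x = F.cl ω κ i ∧ y = F.cl ω κ j
  symm := ⟨by
    rintro x y (h | ⟨κ, hκ, i, j, hij, rfl, rfl⟩)
    · exact Or.inl h.symm
    · exact Or.inr ⟨κ, hκ, j, i, hij.symm, rfl, rfl⟩⟩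
  loopless := ⟨by
    rintro x (h | ⟨κ, hκ, i, j, hij, h1, h2⟩)
    · exact h.ne rfl
    · exact hij (F.cl_inj.1 (h1.symm.trans h2)).2⟩

lemma graph_adj {T : Finset L} {ω : I → Equiv.Perm L} {x y : V} : (F.graph T ω).Adj x y ↔
    F.M.Adj x y ∨ ∃ κ ∈ T, ∃ i j, i ≠ j ∧ x = F.cl ω κ i ∧ y = F.cl ω κ j := Iff.rfl

lemma exists_adj (T : Finset L) (ω : I → Equiv.Perm L) (v : V) :
    ∃ w, (F.graph T ω).Adj v w := by
  classical
  obtain ⟨w, hw⟩ := (F.M.degree_pos_iff_exists_adj v).1 (by convert F.degree_pos v)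
  exact ⟨w, Or.inl hw⟩

open scoped Classical in
lemma neighborFinset_of_not_colored {T : Finset L} {ω : I → Equiv.Perm L} {x : V}
    (hx : ∀ κ ∈ T, ∀ i, x ≠ F.cl ω κ i) :
    (F.graph T ω).neighborFinset x = F.M.neighborFinset x := by
  ext y
  simp only [SimpleGraph.mem_neighborFinset, graph_adj]
  constructor
  · rintro (h | ⟨κ, hκ, i, j, hij, h1, h2⟩)
    · exact h
    · exact absurd h1 (hx κ hκ i)
  · exact Or.inl

open scoped Classical in
lemma degree_of_not_colored {T : Finset L} {ω : I → Equiv.Perm L} {x : V}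
    (hx : ∀ κ ∈ T, ∀ i, x ≠ F.cl ω κ i) : (F.graph T ω).degree x = F.M.degree x := by
  rw [← SimpleGraph.card_neighborFinset_eq_degree, neighborFinset_of_not_colored F hx,
    SimpleGraph.card_neighborFinset_eq_degree]

open scoped Classical in
lemma sum_degree_M_le : ∑ v, F.M.degree v ≤ 2 * Fintype.card V := by
  calc ∑ v, F.M.degree v ≤ ∑ _v : V, 2 := Finset.sum_le_sum fun v _ => F.degree_le v
    _ = _ := by simp [mul_comm]

variable [Fintype I]

open scoped Classical in
lemma neighborFinset_cl {T : Finset L} {ω : I → Equiv.Perm L} {κ : L} (hκ : κ ∈ T) (i : I) :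
    (F.graph T ω).neighborFinset (F.cl ω κ i) =
      F.M.neighborFinset (F.cl ω κ i) ∪ (Finset.univ.erase i).image (F.cl ω κ) := by
  ext y
  simp only [SimpleGraph.mem_neighborFinset, graph_adj, Finset.mem_union, Finset.mem_image,
    Finset.mem_erase, Finset.mem_univ, and_true]
  constructor
  · rintro (h | ⟨κ', hκ', i', j, hij, h1, h2⟩)
    · exact Or.inl h
    · obtain ⟨rfl, rfl⟩ := F.cl_inj.1 h1
      exact Or.inr ⟨j, hij.symm, h2.symm⟩
  · rintro (h | ⟨j, hj, rfl⟩)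
    · exact Or.inl h
    · exact Or.inr ⟨κ, hκ, i, j, hj.symm, rfl, rfl⟩

open scoped Classical in
lemma degree_cl {T : Finset L} {ω : I → Equiv.Perm L} {κ : L} (hκ : κ ∈ T) (i : I) :
    (F.graph T ω).degree (F.cl ω κ i) =
      F.M.degree (F.cl ω κ i) + (Fintype.card I - 1) := by
  rw [← SimpleGraph.card_neighborFinset_eq_degree, neighborFinset_cl F hκ,
    Finset.card_union_of_disjoint, SimpleGraph.card_neighborFinset_eq_degree,
    Finset.card_image_of_injective]
  · simp
  · intro a b hab
    exact (F.cl_inj.1 hab).2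
  -- Clique edges join different blocks and edges of `M` do not, so the two kinds of neighbours are
  -- distinct.
  · rw [Finset.disjoint_left]
    intro y hy hy'
    simp only [SimpleGraph.mem_neighborFinset, Finset.mem_image,
      Finset.mem_erase, Finset.mem_univ, and_true] at hy hy'
    obtain ⟨j, hj, rfl⟩ := hy'
    exact hj (F.eq_of_adj hy).symm

open scoped Classical in
lemma sum_degree (T : Finset L) (ω : I → Equiv.Perm L) :
    ∑ v, (F.graph T ω).degree v =
      ∑ v, F.M.degree v + T.card * (Fintype.card I * (Fintype.card I - 1)) := by
  let D : Finset V := (T ×ˢ Finset.univ).image (fun p : L × I => F.cl ω p.1 p.2)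
  have hD : D.card = T.card * Fintype.card I := by
    rw [Finset.card_image_of_injective, Finset.card_product, Finset.card_univ]
    rintro ⟨a, b⟩ ⟨c, d⟩ h
    have := F.cl_inj.1 h
    simpa using this
  have h : ∀ v, (F.graph T ω).degree v =
      F.M.degree v + if v ∈ D then Fintype.card I - 1 else 0 := by
    intro v
    by_cases hv : v ∈ D
    · rw [if_pos hv]
      simp only [D, Finset.mem_image, Finset.mem_product, Finset.mem_univ, and_true] at hv
      obtain ⟨⟨κ, i⟩, hκ, rfl⟩ := hv
      exact F.degree_cl hκ i
    · rw [if_neg hv, add_zero]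
      refine F.degree_of_not_colored fun κ hκ i h => hv ?_
      simp only [D, Finset.mem_image, Finset.mem_product, Finset.mem_univ, and_true]
      exact ⟨(κ, i), hκ, h.symm⟩
  simp only [h]
  rw [Finset.sum_add_distrib, Finset.sum_ite_mem, Finset.univ_inter, Finset.sum_const, hD,
    smul_eq_mul, mul_assoc]

open scoped Classical in
lemma two_mul_card_edgeFinset_le (T : Finset L) (ω : I → Equiv.Perm L) :
    2 * (F.graph T ω).edgeFinset.card ≤
      2 * Fintype.card V + T.card * (Fintype.card I * (Fintype.card I - 1)) := by
  rw [← SimpleGraph.sum_degrees_eq_twice_card_edges, sum_degree]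
  gcongr
  exact F.sum_degree_M_le

/-- Together with `avgDegree_le`: up to an error of 2, the average degree is proportional to the
number of colours. -/
lemma le_avgDegree [Nonempty V] (T : Finset L) (ω : I → Equiv.Perm L) :
    (T.card * (Fintype.card I * (Fintype.card I - 1) : ℕ) : ℝ) / Fintype.card V ≤
      avgDegree (F.graph T ω) := by
  rw [avgDegree]
  gcongr
  rw [← Nat.cast_sum, sum_degree]
  push_cast
  exact le_add_of_nonneg_left (by positivity)

lemma avgDegree_le [Nonempty V] (T : Finset L) (ω : I → Equiv.Perm L) :
    avgDegree (F.graph T ω) ≤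
      2 + (T.card * (Fintype.card I * (Fintype.card I - 1) : ℕ) : ℝ) / Fintype.card V := by
  have hV : (0 : ℝ) < Fintype.card V := by exact_mod_cast Fintype.card_pos
  rw [avgDegree, div_le_iff₀ hV, add_mul, div_mul_cancel₀ _ hV.ne']
  rw [← Nat.cast_sum, sum_degree, Nat.cast_add]
  have := F.sum_degree_M_le
  gcongr
  · exact_mod_cast this
  · push_cast; rfl

end Graph

end Frame

/-! ### Bookkeeping for histories -/

/-- The vertices about which a query asks. -/
noncomputable def Query.labels {V : Type} : Query V → Finset V
  | .randVert => ∅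
  | .randEdge => ∅
  | .randNbr x => {x}
  | .degree x => {x}
  | .pair x y => open scoped Classical in {x, y}
  | .fullNbrHood x => {x}

section History

variable {V : Type}

open scoped Classical in
/-- The number of queries `RandEdge`. -/
noncomputable def edgeCount : History V → ℕ
  | [] => 0
  | (u, _) :: h => edgeCount h + if u = Query.randEdge then 1 else 0

open scoped Classical in
/-- The vertices about which the queries of a history ask. -/
noncomputable def queried : History V → Finset V
  | [] => ∅
  | (u, _) :: h => u.labels ∪ queried h

lemma edgeCount_le_length (h : History V) : edgeCount h ≤ h.length := by
  induction h with
  | nil => simp [edgeCount]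
  | cons p h ih =>
    obtain ⟨u, a⟩ := p
    rw [edgeCount, List.length_cons]
    split_ifs <;> omega

lemma card_queried_le (h : History V) : (queried h).card ≤ 2 * h.length := by
  classical
  induction h with
  | nil => simp [queried]
  | cons p h ih =>
    obtain ⟨u, a⟩ := p
    have h1 : u.labels.card ≤ 2 := by
      cases u <;> simp [Query.labels, Finset.card_le_two]
    rw [queried, List.length_cons]
    have := Finset.card_union_le u.labels (queried h)
    have h2 := this.trans (Nat.add_le_add h1 ih)
    omega

end History

namespace Frame

/-! ### The reference process and its invariants -/

section Reference

open scoped Classical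

variable {V I L : Type} [Fintype V] [Fintype I] [Fintype L] (F : Frame V I L)

/-- The vertices which become known to be in a clique by the answer `a` to `u`. Here `c` assigns
to each vertex which is known to be in a clique its component, that is the number of the random
edge from which it has been reached. -/
noncomputable def newLabels (c : V → Option ℕ) : Query V → Answer V → Finset V
  | .randEdge, .edge e => Finset.univ.filter fun v => v ∈ e ∧ c v = none
  | .randNbr x, .vertex y => Finset.univ.filter fun v => v = y ∧ c v = none ∧ c x ≠ none
  | .fullNbrHood x, .vertices S =>
      Finset.univ.filter fun v => v ∈ S ∧ ¬ F.M.Adj x v ∧ c v = none ∧ c x ≠ none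
  | _, _ => ∅

/-- The component of the vertices in `newLabels`. -/
noncomputable def target (c : V → Option ℕ) (e : ℕ) : Query V → ℕ
  | .randEdge => e
  | .randNbr x => (c x).getD 0
  | .fullNbrHood x => (c x).getD 0
  | _ => 0

/-- The components of the vertices which are known to be in a clique. -/
noncomputable def comp : History V → V → Option ℕ
  | [] => fun _ => none
  | (u, a) :: h => fun v =>
      if v ∈ F.newLabels (comp h) u a then some (target (comp h) (edgeCount h) u) else comp h v

/-- The vertices which are known to be in a clique. -/
noncomputable def dense (h : History V) : Finset V := Finset.univ.filter fun v => F.comp h v ≠ none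

/-- The vertices about which nothing is known, in blocks about which nothing is known if
`wide` holds. -/
def Fresh (wide : Prop) (h : History V) (v : V) : Prop :=
  v ∉ queried h ∧ F.comp h v = none ∧
    (wide → ∀ i l l', v = F.E (i, l) → F.E (i, l') ∉ queried h ∧ F.comp h (F.E (i, l')) = none)

/-- The answer `a` to `u` is the one given if exactly those vertices are in cliques for which this
is known. -/
def Spec (h : History V) (u : Query V) (a : Answer V) : Prop :=
  match u with
  | .randVert => ∃ v, a = .vertex v
  | .randEdge => ∃ x y, x ≠ y ∧ a = .edge s(x, y) ∧ F.comp h x = none ∧ F.comp h y = none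
  | .randNbr x => ∃ y, a = .vertex y ∧
      if F.comp h x = none then F.M.Adj x y
      else y ≠ x ∧ F.comp ((.randNbr x, a) :: h) y = F.comp h x
  | .degree x =>
      a = .number (F.M.degree x + if F.comp h x = none then 0 else Fintype.card I - 1)
  | .pair x y =>
      a = .bit (decide (F.M.Adj x y ∨ x ≠ y ∧ F.comp h x ≠ none ∧ F.comp h x = F.comp h y))
  | .fullNbrHood x =>
      if F.comp h x = none then a = .vertices (F.M.neighborFinset x)
      else ∃ t : I → L, (∀ i, F.comp ((.fullNbrHood x, a) :: h) (F.E (i, t i)) = F.comp h x) ∧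
        a = .vertices (F.M.neighborFinset x ∪ (Finset.univ.image fun i => F.E (i, t i)).erase x)

/-- The answer `a` to `u` is possible in the reference process. -/
structure Possible (wide : Prop) (h : History V) (u : Query V) (a : Answer V) : Prop where
  fresh : ∀ v ∈ F.newLabels (F.comp h) u a, F.Fresh wide h v
  block : ∀ v ∈ F.newLabels (F.comp h) u a, ∃ i l, v = F.E (i, l) ∧
    ∀ l', F.comp h (F.E (i, l')) ≠ some (target (F.comp h) (edgeCount h) u)
  inj : ∀ i l l', F.E (i, l) ∈ F.newLabels (F.comp h) u a →
    F.E (i, l') ∈ F.newLabels (F.comp h) u a → l = l'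
  spec : F.Spec h u a

/-- The histories which are possible in the reference process. -/
def Valid (wide : Prop) : History V → Prop
  | [] => True
  | (u, a) :: h => Valid wide h ∧ F.Possible wide h u a

/-- The weight of an answer in the reference process, apart from the choice of new vertices. -/
noncomputable def stepWeight (h : History V) : Query V → ℝ
  | .randVert => (Fintype.card V : ℝ)⁻¹
  | .randEdge => 2 / (Fintype.card I * (Fintype.card I - 1))
  | .randNbr x => if F.comp h x = none then (F.M.degree x : ℝ)⁻¹ else (Fintype.card I + 1 : ℝ)⁻¹
  | _ => 1

/-- The weight of a history in the reference process, apart from the choice of new vertices. -/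
noncomputable def weight : History V → ℝ
  | [] => 1
  | (u, _) :: h => F.stepWeight h u * weight h

/-- The labels in the block `i` of the vertices in `D`. -/
noncomputable def labelsIn (D : Finset V) (i : I) : Finset L :=
  Finset.univ.filter fun l => F.E (i, l) ∈ D

/-- The probability that random bijections take prescribed values at the labels of the vertices
in `D`. -/
noncomputable def pin (D : Finset V) : ℝ :=
  ∏ i, ((Fintype.card L).descFactorial (F.labelsIn D i).card : ℝ)⁻¹

/-- The weight of a history in the reference process. -/
noncomputable def ref (wide : Prop) (h : History V) : ℝ :=
  if F.Valid wide h then F.weight h * F.pin (F.dense h) else 0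

variable {F} {wide : Prop} {h : History V} {u : Query V} {a : Answer V}

omit [Fintype I] [Fintype L] in
lemma mem_dense {v : V} : v ∈ F.dense h ↔ F.comp h v ≠ none := by simp [dense]

omit [Fintype I] [Fintype L] in
lemma comp_eq_none_of_mem_newLabels {c : V → Option ℕ} {v : V} (hv : v ∈ F.newLabels c u a) :
    c v = none := by
  unfold newLabels at hv
  split at hv <;> simp at hv <;> tauto

omit [Fintype I] [Fintype L] in
lemma comp_cons_of_mem {v : V} (hv : v ∈ F.newLabels (F.comp h) u a) :
    F.comp ((u, a) :: h) v = some (target (F.comp h) (edgeCount h) u) := by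
  simp only [comp, if_pos hv]

omit [Fintype I] [Fintype L] in
lemma comp_cons_of_notMem {v : V} (hv : v ∉ F.newLabels (F.comp h) u a) :
    F.comp ((u, a) :: h) v = F.comp h v := by
  simp only [comp, if_neg hv]

omit [Fintype I] [Fintype L] in
lemma comp_cons_of_eq_some {v : V} {t : ℕ} (hv : F.comp h v = some t) :
    F.comp ((u, a) :: h) v = some t := by
  rw [comp_cons_of_notMem, hv]
  intro hc
  simp [comp_eq_none_of_mem_newLabels hc] at hv

omit [Fintype I] [Fintype L] in
lemma dense_cons : F.dense ((u, a) :: h) = F.newLabels (F.comp h) u a ∪ F.dense h := by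
  ext v
  rw [Finset.mem_union, mem_dense, mem_dense]
  by_cases hv : v ∈ F.newLabels (F.comp h) u a
  · simp [comp_cons_of_mem hv, hv]
  · simp [comp_cons_of_notMem hv, hv]

-- New clique vertices are fresh, so a vertex that was queried as a plain one stays plain and the
-- earlier answers stay correct.
omit [Fintype L] in
lemma Possible.comp_cons_eq_none (hp : F.Possible wide h u a) {v : V} (hv : v ∈ queried h)
    (hc : F.comp h v = none) : F.comp ((u, a) :: h) v = none := by
  rw [comp_cons_of_notMem, hc]
  exact fun hn => (hp.fresh v hn).1 hv

omit [Fintype I] [Fintype L] in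
lemma target_lt (hlt : ∀ v t, F.comp h v = some t → t < edgeCount h) {v : V}
    (hv : v ∈ F.newLabels (F.comp h) u a) :
    target (F.comp h) (edgeCount h) u < edgeCount ((u, a) :: h) := by
  rw [edgeCount]
  unfold newLabels at hv
  split at hv
  · simp [target]
  · simp only [Finset.mem_filter, ne_eq] at hv
    obtain ⟨t, ht⟩ := Option.ne_none_iff_exists'.1 hv.2.2.2
    have := hlt _ _ ht
    simp only [target, ht, Option.getD_some]
    omega
  · simp only [Finset.mem_filter, ne_eq] at hv
    obtain ⟨t, ht⟩ := Option.ne_none_iff_exists'.1 hv.2.2.2.2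
    have := hlt _ _ ht
    simp only [target, ht, Option.getD_some]
    omega
  · simp at hv

omit [Fintype I] [Fintype L] in
lemma comp_lt {v : V} {t : ℕ} (hv : F.comp h v = some t) : t < edgeCount h := by
  induction h generalizing v t with
  | nil => simp [comp] at hv
  | cons p h ih =>
    obtain ⟨u, a⟩ := p
    by_cases hn : v ∈ F.newLabels (F.comp h) u a
    · rw [comp_cons_of_mem hn, Option.some.injEq] at hv
      exact hv ▸ target_lt (fun v t => ih) hn
    · rw [comp_cons_of_notMem hn] at hv
      have := ih hv
      rw [edgeCount]
      omega

omit [Fintype L] in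
lemma Valid.exists_eq_E (hh : F.Valid wide h) {v : V} (hv : F.comp h v ≠ none) :
    ∃ i l, v = F.E (i, l) := by
  induction h with
  | nil => simp [comp] at hv
  | cons p h ih =>
    obtain ⟨u, a⟩ := p
    by_cases hn : v ∈ F.newLabels (F.comp h) u a
    · obtain ⟨i, l, h1, -⟩ := hh.2.block v hn
      exact ⟨i, l, h1⟩
    · rw [comp_cons_of_notMem hn] at hv
      exact ih hh.1 hv

-- A clique meets each block once. The invariant survives a step since `block` excludes a clash with
-- older vertices of the component and `inj` a clash between two new ones.
omit [Fintype L] in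
lemma Valid.label_unique (hh : F.Valid wide h) {i : I} {l l' : L} {t : ℕ}
    (hl : F.comp h (F.E (i, l)) = some t) (hl' : F.comp h (F.E (i, l')) = some t) : l = l' := by
  induction h generalizing t with
  | nil => simp [comp] at hl
  | cons p h ih =>
    obtain ⟨u, a⟩ := p
    have hb : ∀ l, F.E (i, l) ∈ F.newLabels (F.comp h) u a → ∀ l',
        F.comp h (F.E (i, l')) ≠ some (target (F.comp h) (edgeCount h) u) := by
      intro l hl
      obtain ⟨i', l', h1, h2⟩ := hh.2.block _ hl
      have h3 := F.E.injective h1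
      simp only [Prod.mk.injEq] at h3
      rw [h3.1]
      exact h2
    by_cases hn : F.E (i, l) ∈ F.newLabels (F.comp h) u a <;>
      by_cases hn' : F.E (i, l') ∈ F.newLabels (F.comp h) u a
    · exact hh.2.inj i l l' hn hn'
    · rw [comp_cons_of_mem hn] at hl
      rw [comp_cons_of_notMem hn', ← hl] at hl'
      exact absurd hl' (hb l hn l')
    · rw [comp_cons_of_mem hn'] at hl'
      rw [comp_cons_of_notMem hn, ← hl'] at hl
      exact absurd hl (hb l' hn' l)
    · rw [comp_cons_of_notMem hn] at hl
      rw [comp_cons_of_notMem hn'] at hl'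
      exact ih hh.1 hl hl'

-- In the wide process a block is entered at most once, so different components never meet in a
-- block and positions impose no condition on the colours.
omit [Fintype L] in
lemma Valid.label_unique_of_wide (hw : wide) (hh : F.Valid wide h) {i : I} {l l' : L}
    (hl : F.comp h (F.E (i, l)) ≠ none) (hl' : F.comp h (F.E (i, l')) ≠ none) : l = l' := by
  induction h with
  | nil => simp [comp] at hl
  | cons p h ih =>
    obtain ⟨u, a⟩ := p
    have hb : ∀ l, F.E (i, l) ∈ F.newLabels (F.comp h) u a → ∀ l',
        F.comp h (F.E (i, l')) = none := fun l hl l' =>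
      ((hh.2.fresh _ hl).2.2 hw i l l' rfl).2
    by_cases hn : F.E (i, l) ∈ F.newLabels (F.comp h) u a <;>
      by_cases hn' : F.E (i, l') ∈ F.newLabels (F.comp h) u a
    · exact hh.2.inj i l l' hn hn'
    · rw [comp_cons_of_notMem hn'] at hl'
      exact absurd (hb l hn l') hl'
    · rw [comp_cons_of_notMem hn] at hl
      exact absurd (hb l' hn' l) hl
    · rw [comp_cons_of_notMem hn] at hl
      rw [comp_cons_of_notMem hn'] at hl'
      exact ih hh.1 hl hl'

-- No component is empty, so its colour can be read off from the permutations; see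
-- `Consistent.colors_unique`.
omit [Fintype L] in
lemma Valid.exists_comp_eq (hh : F.Valid wide h) {t : ℕ} (ht : t < edgeCount h) :
    ∃ v, F.comp h v = some t := by
  induction h with
  | nil => simp [edgeCount] at ht
  | cons p h ih =>
    obtain ⟨u, a⟩ := p
    rw [edgeCount] at ht
    by_cases h1 : t < edgeCount h
    · obtain ⟨v, hv⟩ := ih hh.1 h1
      exact ⟨v, comp_cons_of_eq_some hv⟩
    · by_cases hu : u = Query.randEdge
      · subst hu
        rw [if_pos rfl] at ht
        obtain rfl : t = edgeCount h := by omega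
        obtain ⟨x, y, hxy, rfl, hx, hy⟩ := hh.2.spec
        refine ⟨x, ?_⟩
        rw [comp_cons_of_mem]
        · rfl
        · simp [newLabels, hx]
      · rw [if_neg hu] at ht
        omega

omit [Fintype I] in
lemma mem_labelsIn {D : Finset V} {i : I} {l : L} : l ∈ F.labelsIn D i ↔ F.E (i, l) ∈ D := by
  simp [labelsIn]

/-- The known clique vertices of a block lie in different components, and each component comes from
its own random edge. -/
lemma Valid.card_labelsIn_dense_le (hh : F.Valid wide h) (i : I) :
    (F.labelsIn (F.dense h) i).card ≤ edgeCount h := by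
  rw [← Finset.card_range (edgeCount h)]
  refine Finset.card_le_card_of_injOn (fun l => (F.comp h (F.E (i, l))).getD 0) ?_ ?_
  · intro l hl
    rw [Finset.mem_coe, mem_labelsIn, mem_dense] at hl
    obtain ⟨t, ht⟩ := Option.ne_none_iff_exists'.1 hl
    simpa [ht] using comp_lt ht
  · intro l hl l' hl' hll
    rw [Finset.mem_coe, mem_labelsIn, mem_dense] at hl hl'
    obtain ⟨t, ht⟩ := Option.ne_none_iff_exists'.1 hl
    obtain ⟨t', ht'⟩ := Option.ne_none_iff_exists'.1 hl'
    simp only [ht, ht', Option.getD_some] at hll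
    subst hll
    exact hh.label_unique ht ht'

end Reference

end Frame

/-! ### The likelihood of a history on a consistent graph -/

lemma inv_card_le_uniformAnswer {V α : Type} {s : Finset α} (f : α → Answer V) {x : α}
    (hx : x ∈ s) : (s.card : ℝ≥0∞)⁻¹ ≤ uniformAnswer s f (f x) := by
  classical
  have hs : s.Nonempty := ⟨x, hx⟩
  rw [uniformAnswer, dif_pos hs, PMF.map_apply]
  refine le_trans ?_ (ENNReal.le_tsum x)
  rw [if_pos rfl, PMF.uniformOfFinset_apply_of_mem _ hx]

lemma ofReal_inv_natCast {k : ℕ} (hk : 0 < k) :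
    ENNReal.ofReal (k : ℝ)⁻¹ = (k : ℝ≥0∞)⁻¹ := by
  rw [ENNReal.ofReal_inv_of_pos (by exact_mod_cast hk), ENNReal.ofReal_natCast]

lemma ofReal_le_uniformAnswer {V α : Type} {s : Finset α} (f : α → Answer V) {x : α}
    (hx : x ∈ s) {r : ℝ} (hr : r * s.card ≤ 1) : ENNReal.ofReal r ≤ uniformAnswer s f (f x) := by
  have hs : 0 < s.card := Finset.card_pos.2 ⟨x, hx⟩
  refine le_trans ?_ (inv_card_le_uniformAnswer f hx)
  rw [← ofReal_inv_natCast hs]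
  apply ENNReal.ofReal_le_ofReal
  rwa [← one_div, le_div_iff₀ (by exact_mod_cast hs)]

namespace Frame

section Likelihood

open scoped Classical

variable {V I L : Type} [Fintype V] [Fintype I] [Fintype L] (F : Frame V I L)

/-- If the components have the colours given by `κ`, then the cliques given by `ω` explain the
history `h`. -/
structure Consistent (T : Finset L) (κ : ℕ → L) (h : History V) (ω : I → Equiv.Perm L) : Prop where
  colored : ∀ v t, F.comp h v = some t → κ t ∈ T ∧ ∃ i, v = F.cl ω (κ t) i
  plain : ∀ v ∈ queried h, F.comp h v = none → ∀ c ∈ T, ∀ i, v ≠ F.cl ω c i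
  pairs : ∀ p ∈ h, ∀ x y, p.1 = Query.pair x y → ∀ t t', F.comp h x = some t →
    F.comp h y = some t' → t ≠ t' → κ t ≠ κ t'

variable {F} {wide : Prop} {h : History V} {u : Query V} {a : Answer V} {T : Finset L}
  {κ : ℕ → L} {ω : I → Equiv.Perm L}

omit [Fintype L] in
lemma Consistent.of_cons (hp : F.Possible wide h u a) (hc : F.Consistent T κ ((u, a) :: h) ω) :
    F.Consistent T κ h ω where
  colored v t hv := hc.colored v t (comp_cons_of_eq_some hv)
  plain v hv hn := hc.plain v (by rw [queried]; exact Finset.mem_union_right _ hv)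
    (hp.comp_cons_eq_none hv hn)
  pairs p hp x y hxy t t' hx hy := hc.pairs p (List.mem_cons_of_mem _ hp) x y hxy t t'
    (comp_cons_of_eq_some hx) (comp_cons_of_eq_some hy)

omit [Fintype I] [Fintype L] in
lemma Consistent.not_colored (hc : F.Consistent T κ ((u, a) :: h) ω) {v : V}
    (hv : v ∈ u.labels) (hn : F.comp ((u, a) :: h) v = none) : ∀ c ∈ T, ∀ i, v ≠ F.cl ω c i :=
  hc.plain v (by rw [queried]; exact Finset.mem_union_left _ hv) hn

omit [Fintype L] in
lemma degree_graph (hc : F.Consistent T κ h ω) {v : V}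
    (hv : F.comp h v = none → ∀ c ∈ T, ∀ i, v ≠ F.cl ω c i) :
    (F.graph T ω).degree v =
      F.M.degree v + if F.comp h v = none then 0 else Fintype.card I - 1 := by
  by_cases hn : F.comp h v = none
  · rw [if_pos hn, add_zero, F.degree_of_not_colored (hv hn)]
  · rw [if_neg hn]
    obtain ⟨t, ht⟩ := Option.ne_none_iff_exists'.1 hn
    obtain ⟨hT, i, rfl⟩ := hc.colored v t ht
    exact F.degree_cl hT i

-- Consistency makes `a` a possible answer in the graph. The reference weight of a random edge is
-- that of a uniform edge of a single clique; `τ` corrects for the other edges, being at most the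
-- share of one clique among all edges.
omit [Fintype L] in
lemma stepWeight_le_respond (hp : F.Possible wide h u a)
    (hc : F.Consistent T κ ((u, a) :: h) ω) {τ : ℝ}
    (hτ : 2 * τ * (F.graph T ω).edgeFinset.card ≤ Fintype.card I * (Fintype.card I - 1)) :
    ENNReal.ofReal (F.stepWeight h u * τ ^ (if u = Query.randEdge then 1 else 0)) ≤
      respond (F.graph T ω) u a := by
  have hc' := hc.of_cons hp
  have hplain : ∀ v ∈ u.labels, F.newLabels (F.comp h) u a = ∅ → F.comp h v = none →
      ∀ c ∈ T, ∀ i, v ≠ F.cl ω c i := by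
    intro v hv hne hn
    refine hc.not_colored hv ?_
    rw [comp_cons_of_notMem (by simp [hne]), hn]
  have hspec := hp.spec
  cases u with
  | randVert =>
    obtain ⟨v, rfl⟩ := hspec
    refine ofReal_le_uniformAnswer Answer.vertex (Finset.mem_univ v) ?_
    rw [Finset.card_univ]
    simp only [stepWeight, reduceCtorEq, if_false, pow_zero, mul_one]
    exact inv_mul_le_one
  | randEdge =>
    obtain ⟨x, y, hxy, rfl, hx, hy⟩ := hspec
    have hx' : F.comp ((Query.randEdge, Answer.edge s(x, y)) :: h) x = some (edgeCount h) :=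
      comp_cons_of_mem (by simp [newLabels, hx])
    have hy' : F.comp ((Query.randEdge, Answer.edge s(x, y)) :: h) y = some (edgeCount h) :=
      comp_cons_of_mem (by simp [newLabels, hy])
    obtain ⟨hT, i, rfl⟩ := hc.colored _ _ hx'
    obtain ⟨-, j, rfl⟩ := hc.colored _ _ hy'
    have hij : i ≠ j := by rintro rfl; exact hxy rfl
    refine ofReal_le_uniformAnswer Answer.edge (s := (F.graph T ω).edgeFinset)
      (x := s(F.cl ω (κ (edgeCount h)) i, F.cl ω (κ (edgeCount h)) j)) ?_ ?_
    · rw [SimpleGraph.mem_edgeFinset, SimpleGraph.mem_edgeSet]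
      exact Or.inr ⟨_, hT, i, j, hij, rfl, rfl⟩
    · have hI : (1 : ℝ) < Fintype.card I := by
        exact_mod_cast Fintype.one_lt_card_iff.2 ⟨i, j, hij⟩
      have hI' : (0 : ℝ) < Fintype.card I * (Fintype.card I - 1) := by
        apply mul_pos <;> linarith
      simp only [stepWeight, if_true, pow_one]
      rw [div_mul_eq_mul_div, div_mul_eq_mul_div, div_le_one hI']
      exact hτ
  | randNbr x =>
    obtain ⟨y, rfl, hy⟩ := hspec
    have hadj : y ∈ (F.graph T ω).neighborFinset x := by
      rw [SimpleGraph.mem_neighborFinset]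
      by_cases hn : F.comp h x = none
      · rw [if_pos hn] at hy
        exact Or.inl hy
      · rw [if_neg hn] at hy
        obtain ⟨t, ht⟩ := Option.ne_none_iff_exists'.1 hn
        rw [ht] at hy
        obtain ⟨hT, i, rfl⟩ := hc'.colored x t ht
        obtain ⟨-, j, rfl⟩ := hc.colored y t hy.2
        exact Or.inr ⟨_, hT, i, j, by rintro rfl; exact hy.1 rfl, rfl, rfl⟩
    refine ofReal_le_uniformAnswer Answer.vertex hadj ?_
    have hd := degree_graph hc' (v := x) (by
      intro hn
      refine hplain x (by simp [Query.labels]) ?_ hn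
      simp [newLabels, hn])
    rw [SimpleGraph.card_neighborFinset_eq_degree, hd]
    simp only [stepWeight, reduceCtorEq, if_false, pow_zero, mul_one]
    by_cases hn : F.comp h x = none
    · simp only [if_pos hn, add_zero]
      exact inv_mul_le_one
    · simp only [if_neg hn]
      rw [inv_mul_le_one₀ (by positivity)]
      have h1 := F.degree_le x
      have h2 : 0 < Fintype.card I := by
        obtain ⟨t, ht⟩ := Option.ne_none_iff_exists'.1 hn
        obtain ⟨-, i, -⟩ := hc'.colored x t ht
        exact Fintype.card_pos_iff.2 ⟨i⟩
      -- At most 2 neighbours come from `M` and `|I| - 1` from the clique, hence the `|I| + 1` in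
      -- `stepWeight`.
      have h3 : F.M.degree x + (Fintype.card I - 1) ≤ Fintype.card I + 1 := by omega
      exact_mod_cast h3
  | degree x =>
    have hd := degree_graph hc' (v := x) (hplain x (by simp [Query.labels]) rfl)
    simp only [Spec] at hspec
    rw [hspec, ← hd]
    simp [respond, stepWeight]
  | pair x y =>
    simp only [Spec] at hspec
    have hxp := hplain x (by simp [Query.labels]) rfl
    have hyp := hplain y (by simp [Query.labels]) rfl
    have key : (F.graph T ω).Adj x y ↔
        F.M.Adj x y ∨ x ≠ y ∧ F.comp h x ≠ none ∧ F.comp h x = F.comp h y := by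
      rw [graph_adj]
      refine or_congr Iff.rfl ⟨?_, ?_⟩
      · rintro ⟨c, hcT, i, j, hij, rfl, rfl⟩
        have hx : F.comp h (F.cl ω c i) ≠ none := fun hn => hxp hn c hcT i rfl
        have hy : F.comp h (F.cl ω c j) ≠ none := fun hn => hyp hn c hcT j rfl
        refine ⟨fun he => hij (F.cl_inj.1 he).2, hx, ?_⟩
        obtain ⟨t, ht⟩ := Option.ne_none_iff_exists'.1 hx
        obtain ⟨t', ht'⟩ := Option.ne_none_iff_exists'.1 hy
        rw [ht, ht']
        -- Two vertices of a common clique in different components would give these components equal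
        -- colours, but a pair query about them requires different ones.
        by_contra hne
        obtain ⟨-, i', hi'⟩ := hc'.colored _ _ ht
        obtain ⟨-, j', hj'⟩ := hc'.colored _ _ ht'
        refine hc.pairs _ List.mem_cons_self _ _ rfl t t' (comp_cons_of_eq_some ht)
          (comp_cons_of_eq_some ht') (fun e => hne (by rw [e])) ?_
        rw [← (F.cl_inj.1 hi').1, ← (F.cl_inj.1 hj').1]
      · rintro ⟨hxy, hn, he⟩
        obtain ⟨t, ht⟩ := Option.ne_none_iff_exists'.1 hn
        obtain ⟨hT, i, rfl⟩ := hc'.colored _ _ ht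
        obtain ⟨-, j, rfl⟩ := hc'.colored _ _ (he ▸ ht)
        exact ⟨_, hT, i, j, by rintro rfl; exact hxy rfl, rfl, rfl⟩
    rw [hspec, respond]
    have : decide ((F.graph T ω).Adj x y) = decide (F.M.Adj x y ∨ x ≠ y ∧ F.comp h x ≠ none ∧
        F.comp h x = F.comp h y) := by simp only [key]
    rw [this]
    simp [stepWeight]
  | fullNbrHood x =>
    simp only [Spec] at hspec
    have : a = Answer.vertices ((F.graph T ω).neighborFinset x) := by
      by_cases hn : F.comp h x = none
      · rw [if_pos hn] at hspec
        rw [hspec, F.neighborFinset_of_not_colored]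
        refine hplain x (by simp [Query.labels]) ?_ hn
        rw [hspec]
        simp [newLabels, hn]
      · rw [if_neg hn] at hspec
        obtain ⟨t, ht⟩ := Option.ne_none_iff_exists'.1 hn
        rw [ht] at hspec
        obtain ⟨f, hf, ha⟩ := hspec
        obtain ⟨hT, i, hx⟩ := hc'.colored _ _ ht
        have hf' : ∀ j, F.E (j, f j) = F.cl ω (κ t) j := by
          intro j
          obtain ⟨-, j', hj'⟩ := hc.colored _ _ (hf j)
          have h1 := F.E.injective hj'
          simp only [Prod.mk.injEq] at h1
          rw [hj', h1.1]
        rw [ha]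
        congr 1
        rw [hx, F.neighborFinset_cl hT]
        congr 1
        ext v
        simp only [Finset.mem_erase, Finset.mem_image, Finset.mem_univ, true_and, and_true, hf']
        constructor
        · rintro ⟨h1, j, rfl⟩
          exact ⟨j, by rintro rfl; exact h1 rfl, rfl⟩
        · rintro ⟨j, h1, rfl⟩
          exact ⟨fun h2 => h1 (F.cl_inj.1 h2).2, j, rfl⟩
    rw [this, respond]
    simp [stepWeight]

omit [Fintype L] in
lemma stepWeight_nonneg (h : History V) (u : Query V) : 0 ≤ F.stepWeight h u := by
  unfold stepWeight
  split
  · positivity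
  · rcases Nat.eq_zero_or_pos (Fintype.card I) with hI | hI
    · simp [hI]
    · have : (1 : ℝ) ≤ Fintype.card I := by exact_mod_cast hI
      have : (0 : ℝ) ≤ Fintype.card I - 1 := by linarith
      positivity
  · split_ifs <;> positivity
  · exact zero_le_one

omit [Fintype L] in
lemma weight_nonneg (h : History V) : 0 ≤ F.weight h := by
  induction h with
  | nil => exact zero_le_one
  | cons p h ih => exact mul_nonneg (stepWeight_nonneg h p.1) ih

omit [Fintype L] in
lemma weight_le_lik (hh : F.Valid wide h) (hc : F.Consistent T κ h ω) {τ : ℝ} (hτ0 : 0 ≤ τ)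
    (hτ : 2 * τ * (F.graph T ω).edgeFinset.card ≤ Fintype.card I * (Fintype.card I - 1)) :
    ENNReal.ofReal (F.weight h * τ ^ edgeCount h) ≤ lik (F.graph T ω) h := by
  induction h with
  | nil => simp [weight, edgeCount, lik]
  | cons p h ih =>
    obtain ⟨u, a⟩ := p
    have e : F.weight ((u, a) :: h) * τ ^ edgeCount ((u, a) :: h) =
        (F.stepWeight h u * τ ^ (if u = Query.randEdge then 1 else 0)) *
          (F.weight h * τ ^ edgeCount h) := by
      rw [weight, edgeCount, pow_add]
      ring
    rw [e, lik, ENNReal.ofReal_mul (mul_nonneg (stepWeight_nonneg h u) (by positivity))]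
    exact mul_le_mul' (stepWeight_le_respond hh.2 hc hτ) (ih hh.1 (hc.of_cons hh.2))

end Likelihood

end Frame

/-! ### Counting permutations and colourings -/

section Permutations

open scoped Classical

variable {I L : Type} [Fintype I] [Fintype L]

/-- The permutations which map `c l` to `l` for all `l` in `B`. -/
noncomputable def pinned (c : L → L) (B : Finset L) : Finset (Equiv.Perm L) :=
  Finset.univ.filter fun σ => ∀ l ∈ B, σ (c l) = l

lemma mem_pinned {c : L → L} {B : Finset L} {σ : Equiv.Perm L} :
    σ ∈ pinned c B ↔ ∀ l ∈ B, σ (c l) = l := by simp [pinned]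

/-- Composition with the transposition of `k` and `k'` exchanges their values and leaves the pinned
ones alone. -/
lemma card_pinned_filter_le {c : L → L} {B : Finset L} {l : L} {k k' : L}
    (hk : k ∉ B.image c) (hk' : k' ∉ B.image c) :
    ((pinned c B).filter fun σ => σ k = l).card ≤ ((pinned c B).filter fun σ => σ k' = l).card := by
  refine Finset.card_le_card_of_injOn (fun σ => σ * Equiv.swap k k') ?_
    (fun σ _ σ' _ h => mul_right_cancel h)
  intro σ hσ
  simp only [Finset.coe_filter, Set.mem_ofPred_eq, mem_pinned] at hσ ⊢
  refine ⟨fun b hb => ?_, by simp [hσ.2]⟩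
  rw [Equiv.Perm.mul_apply, Equiv.swap_apply_of_ne_of_ne, hσ.1 b hb]
  · exact fun h => hk (h ▸ Finset.mem_image_of_mem c hb)
  · exact fun h => hk' (h ▸ Finset.mem_image_of_mem c hb)

/-- By this symmetry the preimage of an unpinned label is equidistributed over the unpinned points.
-/
lemma card_pinned_filter {c : L → L} {B : Finset L} (hc : Set.InjOn c B) {l : L} (hl : l ∉ B)
    {k : L} (hk : k ∉ B.image c) :
    (Fintype.card L - B.card) * ((pinned c B).filter fun σ => σ k = l).card =
      (pinned c B).card := by
  rw [Finset.card_eq_sum_card_fiberwise (s := pinned c B)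
    (f := fun σ : Equiv.Perm L => σ⁻¹ l) (t := Finset.univ \ B.image c)]
  · rw [Finset.sum_congr rfl (g := fun _ => ((pinned c B).filter fun σ => σ k = l).card)]
    · rw [Finset.sum_const, Finset.card_sdiff_of_subset (Finset.subset_univ _),
        Finset.card_image_of_injOn hc, Finset.card_univ, smul_eq_mul]
    · intro k' hk'
      rw [Finset.mem_sdiff] at hk'
      have : ∀ σ : Equiv.Perm L, σ⁻¹ l = k' ↔ σ k' = l := fun σ => by
        rw [Equiv.Perm.inv_eq_iff_eq]; exact eq_comm
      simp only [this]
      exact le_antisymm (card_pinned_filter_le hk'.2 hk) (card_pinned_filter_le hk hk'.2)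
  · intro σ hσ
    simp only [Finset.mem_coe, mem_pinned, Finset.coe_sdiff, Finset.coe_univ, Set.mem_sdiff,
      Set.mem_univ, true_and, Finset.mem_image, not_exists, not_and] at hσ ⊢
    intro b hb h
    have h1 := hσ b hb
    rw [h, show σ (σ⁻¹ l) = l from σ.apply_symm_apply l] at h1
    exact hl (h1 ▸ hb)

lemma mul_card_pinned_filter_le {c : L → L} {B : Finset L} (hc : Set.InjOn c B) {l : L}
    (hl : l ∉ B) (k : L) :
    (Fintype.card L - B.card) * ((pinned c B).filter fun σ => σ k = l).card ≤
      (pinned c B).card := by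
  by_cases hk : k ∈ B.image c
  · rw [Finset.mem_image] at hk
    obtain ⟨b, hb, rfl⟩ := hk
    rw [Finset.filter_false_of_mem, Finset.card_empty]
    · simp
    · intro σ hσ h
      rw [mem_pinned.1 hσ b hb] at h
      exact hl (h ▸ hb)
  · exact (card_pinned_filter hc hl hk).le

lemma descFactorial_mul_card_pinned {c : L → L} {B : Finset L} (hc : Set.InjOn c B) :
    (Fintype.card L).descFactorial B.card * (pinned c B).card = (Fintype.card L).factorial := by
  induction B using Finset.induction_on with
  | empty => simp [pinned, Fintype.card_perm]
  | insert l B hl ih =>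
    have hcB : Set.InjOn c B := hc.mono (by simp)
    have hk : c l ∉ B.image c := by
      rw [Finset.mem_image]
      rintro ⟨b, hb, h⟩
      have := hc (by simp [hb]) (by simp) h
      exact hl (this ▸ hb)
    have h1 : pinned c (insert l B) = (pinned c B).filter fun σ => σ (c l) = l := by
      ext σ
      simp [mem_pinned, and_comm]
    rw [Finset.card_insert_of_notMem hl, Nat.descFactorial_succ, h1, mul_comm (_ - _), mul_assoc,
      card_pinned_filter hcB hl hk, ih hcB]

/-- The families of permutations which map `c i l` to `l` for all `l` in `B i`. -/
noncomputable def pinnedFamilies (c : I → L → L) (B : I → Finset L) :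
    Finset (I → Equiv.Perm L) :=
  Fintype.piFinset fun i => pinned (c i) (B i)

lemma mem_pinnedFamilies {c : I → L → L} {B : I → Finset L} {ω : I → Equiv.Perm L} :
    ω ∈ pinnedFamilies c B ↔ ∀ i, ∀ l ∈ B i, ω i (c i l) = l := by
  simp [pinnedFamilies, Fintype.mem_piFinset, mem_pinned]

lemma card_pinnedFamilies {c : I → L → L} {B : I → Finset L} (hc : ∀ i, Set.InjOn (c i) (B i)) :
    ((pinnedFamilies c B).card : ℝ) = Fintype.card (I → Equiv.Perm L) *
      ∏ i, ((Fintype.card L).descFactorial (B i).card : ℝ)⁻¹ := by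
  rw [pinnedFamilies, Fintype.card_piFinset, Fintype.card_pi, Nat.cast_prod, Nat.cast_prod,
    ← Finset.prod_mul_distrib]
  refine Finset.prod_congr rfl fun i _ => ?_
  rw [Fintype.card_perm, ← descFactorial_mul_card_pinned (hc i)]
  have : ((Fintype.card L).descFactorial (B i).card : ℝ) ≠ 0 := by
    rw [Nat.cast_ne_zero, Ne, Nat.descFactorial_eq_zero_iff_lt, not_lt]
    exact Finset.card_le_univ _
  push_cast
  field_simp

lemma mul_card_pinnedFamilies_filter_le {c : I → L → L} {B : I → Finset L}
    (hc : ∀ i, Set.InjOn (c i) (B i)) {i : I} {l : L} (hl : l ∉ B i) (k : L) :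
    (Fintype.card L - (B i).card) * ((pinnedFamilies c B).filter fun ω => ω i k = l).card ≤
      (pinnedFamilies c B).card := by
  have h1 : (pinnedFamilies c B).filter (fun ω => ω i k = l) =
      Fintype.piFinset (Function.update (fun i => pinned (c i) (B i)) i
        ((pinned (c i) (B i)).filter fun σ => σ k = l)) := by
    ext ω
    rw [Finset.mem_filter, pinnedFamilies, Fintype.mem_piFinset, Fintype.mem_piFinset]
    constructor
    · rintro ⟨h1, h2⟩ j
      by_cases hj : j = i
      · subst hj
        simp [h1, h2]
      · simpa [hj] using h1 j
    · intro h
      have hi := h i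
      simp only [Function.update_self, Finset.mem_filter] at hi
      refine ⟨fun j => ?_, hi.2⟩
      by_cases hj : j = i
      · subst hj
        exact hi.1
      · simpa [hj] using h j
  rw [h1, pinnedFamilies, Fintype.card_piFinset, Fintype.card_piFinset,
    Fintype.prod_eq_mul_prod_compl i, Fintype.prod_eq_mul_prod_compl i, Function.update_self,
    ← mul_assoc]
  refine Nat.mul_le_mul (mul_card_pinned_filter_le (hc i) hl k) (le_of_eq ?_)
  refine Finset.prod_congr rfl fun j hj => ?_
  rw [Finset.mem_compl, Finset.mem_singleton] at hj
  rw [Function.update_of_ne hj]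

/-- The families of permutations in `pinnedFamilies c B` which do not map a member of `T` to a
label in a set `Q` of further labels. -/
lemma le_card_pinnedFamilies_filter {c : I → L → L} {B : I → Finset L}
    (hc : ∀ i, Set.InjOn (c i) (B i)) (T : Finset L) (Q : Finset (I × L))
    (hQ : ∀ p ∈ Q, p.2 ∉ B p.1) {b : ℕ} (hB : ∀ i, (B i).card ≤ b) (hb : b < Fintype.card L) :
    ((pinnedFamilies c B).card : ℝ) * (1 - Q.card * T.card / (Fintype.card L - b : ℕ)) ≤
      ((pinnedFamilies c B).filter fun ω => ∀ p ∈ Q, ∀ k ∈ T, ω p.1 k ≠ p.2).card := by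
  have hpos : (0 : ℝ) < (Fintype.card L - b : ℕ) := by
    exact_mod_cast Nat.sub_pos_of_lt hb
  have hsub : (pinnedFamilies c B) \
      ((pinnedFamilies c B).filter fun ω => ∀ p ∈ Q, ∀ k ∈ T, ω p.1 k ≠ p.2) ⊆
      (Q ×ˢ T).biUnion fun r => (pinnedFamilies c B).filter fun ω => ω r.1.1 r.2 = r.1.2 := by
    intro ω hω
    rw [Finset.mem_sdiff, Finset.mem_filter] at hω
    have h1 : ¬ ∀ p ∈ Q, ∀ k ∈ T, ω p.1 k ≠ p.2 := fun h => hω.2 ⟨hω.1, h⟩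
    push Not at h1
    obtain ⟨p, hp, k, hk, h⟩ := h1
    rw [Finset.mem_biUnion]
    exact ⟨(p, k), Finset.mem_product.2 ⟨hp, hk⟩, Finset.mem_filter.2 ⟨hω.1, h⟩⟩
  have h1 := (Finset.card_le_card hsub).trans Finset.card_biUnion_le
  rw [Finset.card_sdiff_of_subset (Finset.filter_subset _ _)] at h1
  -- Union bound: given the pinned values, each bad event has probability at most `1 / (|L| - b)`.
  have h2 : ∀ r ∈ Q ×ˢ T,
      (((pinnedFamilies c B).filter fun ω => ω r.1.1 r.2 = r.1.2).card : ℝ) ≤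
        (pinnedFamilies c B).card / (Fintype.card L - b : ℕ) := by
    intro r hr
    rw [le_div_iff₀ hpos, mul_comm]
    have h3 := mul_card_pinnedFamilies_filter_le hc (hQ r.1 (Finset.mem_product.1 hr).1) r.2
    have h4 : Fintype.card L - b ≤ Fintype.card L - (B r.1.1).card :=
      Nat.sub_le_sub_left (hB _) _
    exact_mod_cast (Nat.mul_le_mul_right _ h4).trans h3
  have h3 : ((∑ r ∈ Q ×ˢ T,
      ((pinnedFamilies c B).filter fun ω => ω r.1.1 r.2 = r.1.2).card : ℕ) : ℝ) ≤
      (Q.card * T.card) * ((pinnedFamilies c B).card / (Fintype.card L - b : ℕ)) := by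
    rw [Nat.cast_sum]
    refine (Finset.sum_le_sum h2).trans ?_
    rw [Finset.sum_const, Finset.card_product, nsmul_eq_mul]
    push_cast
    rfl
  have h4 : (((pinnedFamilies c B).card : ℝ) -
      ((pinnedFamilies c B).filter fun ω => ∀ p ∈ Q, ∀ k ∈ T, ω p.1 k ≠ p.2).card) ≤
      (Q.card * T.card) * ((pinnedFamilies c B).card / (Fintype.card L - b : ℕ)) := by
    refine le_trans ?_ h3
    rw [← Nat.cast_sub (Finset.card_filter_le _ _)]
    exact_mod_cast h1
  have h5 : ((pinnedFamilies c B).card : ℝ) * (1 - Q.card * T.card / (Fintype.card L - b : ℕ)) =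
      (pinnedFamilies c B).card -
      (Q.card * T.card) * ((pinnedFamilies c B).card / (Fintype.card L - b : ℕ)) := by
    field_simp
  linarith

omit [Fintype L] in
/-- Among the functions with values in `T`, most separate all pairs in `C`. -/
lemma le_card_separating {e : ℕ} (T : Finset L) (C : Finset (Fin e × Fin e))
    (hC : ∀ p ∈ C, p.1 ≠ p.2) :
    (T.card : ℝ) ^ e * (1 - C.card / T.card) ≤
      ((Fintype.piFinset fun _ : Fin e => T).filter fun κ => ∀ p ∈ C, κ p.1 ≠ κ p.2).card := by
  rcases T.eq_empty_or_nonempty with rfl | hT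
  · rcases Nat.eq_zero_or_pos e with rfl | he
    · have : C = ∅ := Finset.eq_empty_of_forall_notMem fun p => p.1.elim0
      subst this
      simp
    · simp [he.ne']
  have hpos : (0 : ℝ) < T.card := by exact_mod_cast hT.card_pos
  set K := Fintype.piFinset fun _ : Fin e => T with hK
  have hKcard : (K.card : ℝ) = (T.card : ℝ) ^ e := by
    rw [hK, Fintype.card_piFinset]
    simp
  have hsub : K \ (K.filter fun κ => ∀ p ∈ C, κ p.1 ≠ κ p.2) ⊆
      C.biUnion fun p => K.filter fun κ => κ p.1 = κ p.2 := by
    intro κ hκ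
    rw [Finset.mem_sdiff, Finset.mem_filter] at hκ
    have h1 : ¬ ∀ p ∈ C, κ p.1 ≠ κ p.2 := fun h => hκ.2 ⟨hκ.1, h⟩
    push Not at h1
    obtain ⟨p, hp, h⟩ := h1
    rw [Finset.mem_biUnion]
    exact ⟨p, hp, Finset.mem_filter.2 ⟨hκ.1, h⟩⟩
  have h1 := (Finset.card_le_card hsub).trans Finset.card_biUnion_le
  rw [Finset.card_sdiff_of_subset (Finset.filter_subset _ _)] at h1
  have h2 : ∀ p ∈ C, ((K.filter fun κ => κ p.1 = κ p.2).card : ℝ) ≤ T.card ^ e / T.card := by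
    intro p hp
    rw [le_div_iff₀ hpos, ← hKcard]
    -- Overwriting the value at `p.1` by an arbitrary member of `T` is injective here: the lost
    -- value is still present at `p.2`.
    have : ((K.filter fun κ => κ p.1 = κ p.2) ×ˢ T).card ≤ K.card := by
      refine Finset.card_le_card_of_injOn (fun r => Function.update r.1 p.1 r.2) ?_ ?_
      · intro r hr
        simp only [Finset.coe_product, Finset.coe_filter, Set.mem_prod, Set.mem_ofPred_eq,
          Finset.mem_coe, hK, Fintype.mem_piFinset] at hr ⊢
        intro t
        by_cases ht : t = p.1
        · subst ht
          simpa using hr.2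
        · simpa [ht] using hr.1.1 t
      · rintro ⟨κ, x⟩ hr ⟨κ', x'⟩ hr' h
        simp only [Finset.coe_product, Finset.coe_filter, Set.mem_prod, Set.mem_ofPred_eq,
          Finset.mem_coe] at hr hr' h
        have hne : ∀ t, t ≠ p.1 → κ t = κ' t := by
          intro t ht
          have := congrFun h t
          simpa [ht] using this
        have hx := congrFun h p.1
        simp only [Function.update_self] at hx
        refine Prod.ext (funext fun t => ?_) hx
        by_cases ht : t = p.1
        · rw [ht]
          simp only
          rw [hr.1.2, hr'.1.2, hne _ (hC p hp).symm]
        · exact hne t ht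
    rw [Finset.card_product] at this
    exact_mod_cast this
  have h3 : ((∑ p ∈ C, (K.filter fun κ => κ p.1 = κ p.2).card : ℕ) : ℝ) ≤
      C.card * (T.card ^ e / T.card) := by
    rw [Nat.cast_sum]
    refine (Finset.sum_le_sum h2).trans ?_
    rw [Finset.sum_const, nsmul_eq_mul]
  have h4 : (K.card : ℝ) - (K.filter fun κ => ∀ p ∈ C, κ p.1 ≠ κ p.2).card ≤
      C.card * (T.card ^ e / T.card) := by
    refine le_trans ?_ h3
    rw [← Nat.cast_sub (Finset.card_filter_le _ _)]
    exact_mod_cast h1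
  have h5 : (T.card : ℝ) ^ e * (1 - C.card / T.card) =
      (T.card : ℝ) ^ e - C.card * (T.card ^ e / T.card) := by
    field_simp
  rw [hKcard] at h4
  linarith

end Permutations

namespace Frame

/-! ### Averaging the likelihood over the hidden cliques -/

section AverageLikelihood

open scoped Classical

variable {V I L : Type} [Fintype V] [Fintype I] [Fintype L] {F : Frame V I L} {wide : Prop}
  {h : History V} {T : Finset L}

/-- The extension of a colouring of the components `0, …, e - 1`. -/
noncomputable def extendColors (l₀ : L) {e : ℕ} (κ : Fin e → L) (t : ℕ) : L :=
  if ht : t < e then κ ⟨t, ht⟩ else l₀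

-- The permutations determine the colours of the components, so a sum over colourings counts no
-- graph twice.
omit [Fintype L] in
lemma Consistent.colors_unique (hh : F.Valid wide h) {l₀ : L} {κ κ' : Fin (edgeCount h) → L}
    {ω : I → Equiv.Perm L} (hc : F.Consistent T (extendColors l₀ κ) h ω)
    (hc' : F.Consistent T (extendColors l₀ κ') h ω) : κ = κ' := by
  funext t
  obtain ⟨v, hv⟩ := hh.exists_comp_eq t.2
  obtain ⟨-, i, hi⟩ := hc.colored v t hv
  obtain ⟨-, j, hj⟩ := hc'.colored v t hv
  have := (F.cl_inj.1 (hi.symm.trans hj)).1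
  simpa [extendColors] using this

/-- The labels of vertices which are known not to be in a clique. -/
noncomputable def plainLabels (F : Frame V I L) (h : History V) : Finset (I × L) :=
  Finset.univ.filter fun p => F.E p ∈ queried h ∧ F.comp h (F.E p) = none

lemma card_plainLabels_le : (F.plainLabels h).card ≤ 2 * h.length := by
  refine le_trans ?_ (card_queried_le h)
  refine Finset.card_le_card_of_injOn F.E ?_ F.E.injective.injOn
  intro p hp
  simp only [plainLabels, Finset.coe_filter, Set.mem_ofPred_eq] at hp
  exact hp.2.1

lemma consistent_of_mem {κ : ℕ → L} (hh : F.Valid wide h)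
    (hT : ∀ t < edgeCount h, κ t ∈ T)
    (hpairs : ∀ p ∈ h, ∀ x y, p.1 = Query.pair x y → ∀ t t', F.comp h x = some t →
      F.comp h y = some t' → t ≠ t' → κ t ≠ κ t')
    {ω : I → Equiv.Perm L}
    (hω : ω ∈ pinnedFamilies (fun i l => κ ((F.comp h (F.E (i, l))).getD 0))
      (F.labelsIn (F.dense h)))
    (hQ : ∀ p ∈ F.plainLabels h, ∀ k ∈ T, ω p.1 k ≠ p.2) :
    F.Consistent T κ h ω where
  colored v t hv := by
    refine ⟨hT t (comp_lt hv), ?_⟩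
    obtain ⟨i, l, rfl⟩ := hh.exists_eq_E (v := v) (by simp [hv])
    refine ⟨i, ?_⟩
    have h1 := mem_pinnedFamilies.1 hω i l (by rw [mem_labelsIn, mem_dense, hv]; simp)
    simp only [hv, Option.getD_some] at h1
    rw [cl, h1]
  plain v hv hn c hc i := by
    rintro rfl
    refine hQ (i, ω i c) ?_ c hc rfl
    simp only [plainLabels, Finset.mem_filter, Finset.mem_univ, true_and]
    exact ⟨hv, hn⟩
  pairs := hpairs

/-- For each colouring that separates the conflicts, a proportion of about `pin` of the permutations
is consistent with the history, and each of them has likelihood at least `weight * τ ^ e`. The three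
factors `1 - δ` pay for the colourings that are not separating, for the permutations that put a
clique at a plain label, and for the difference between `(|T| τ) ^ e` and 1. The `|T| ^ e`
colourings compensate `τ ^ e`, so `T` disappears from the bound. -/
lemma pow_three_mul_ref_le_tsum_lik (hh : F.Valid wide h) (hT : T.Nonempty) {τ δ : ℝ}
    (hτ0 : 0 ≤ τ)
    (hτ : ∀ ω, 2 * τ * (F.graph T ω).edgeFinset.card ≤ Fintype.card I * (Fintype.card I - 1))
    {b : ℕ} (hb : h.length ≤ b) (hbL : b < Fintype.card L) (C : Finset (ℕ × ℕ))
    (hCpairs : ∀ p ∈ h, ∀ x y, p.1 = Query.pair x y → ∀ t t', F.comp h x = some t →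
      F.comp h y = some t' → t ≠ t' → (t, t') ∈ C)
    (hCblock : ∀ i l l' t t', F.comp h (F.E (i, l)) = some t → F.comp h (F.E (i, l')) = some t' →
      l ≠ l' → (t, t') ∈ C)
    (hδ : δ ≤ 1) (hδC : C.card ≤ δ * T.card) (hδb : 2 * b * T.card ≤ δ * (Fintype.card L - b : ℕ))
    (hδτ : 1 - δ ≤ (T.card * τ) ^ edgeCount h) :
    ENNReal.ofReal ((1 - δ) ^ 3 * Fintype.card (I → Equiv.Perm L) * F.ref wide h) ≤
      ∑' ω, lik (F.graph T ω) h := by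
  obtain ⟨l₀, hl₀⟩ := hT
  set e := edgeCount h with he
  set K := Fintype.piFinset fun _ : Fin e => T with hK
  set Cf : Finset (Fin e × Fin e) :=
    Finset.univ.filter fun p => p.1 ≠ p.2 ∧ ((p.1 : ℕ), (p.2 : ℕ)) ∈ C with hCf
  set K' := K.filter fun κ => ∀ p ∈ Cf, κ p.1 ≠ κ p.2 with hK'
  have hTpos : (0 : ℝ) < T.card := by exact_mod_cast Finset.card_pos.2 ⟨l₀, hl₀⟩
  have hLb : (0 : ℝ) < (Fintype.card L - b : ℕ) := by exact_mod_cast Nat.sub_pos_of_lt hbL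
  have hCfcard : Cf.card ≤ C.card := by
    refine Finset.card_le_card_of_injOn (fun p => ((p.1 : ℕ), (p.2 : ℕ))) ?_ ?_
    · intro p hp
      simp only [hCf, Finset.coe_filter, Set.mem_ofPred_eq] at hp
      exact hp.2.2
    · rintro ⟨a, b⟩ - ⟨c, d⟩ - h1
      simp only [Prod.mk.injEq] at h1
      exact Prod.ext (Fin.ext h1.1) (Fin.ext h1.2)
  have hK'card : (T.card : ℝ) ^ e * (1 - δ) ≤ K'.card := by
    refine le_trans ?_ (le_card_separating T Cf fun p hp => by
      simp only [hCf, Finset.mem_filter] at hp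
      exact hp.2.1)
    gcongr
    rw [div_le_iff₀ hTpos]
    refine le_trans ?_ hδC
    exact_mod_cast hCfcard
  have hsep : ∀ κ ∈ K', ∀ t t', t ≠ t' → (ht : t < e) → (ht' : t' < e) → (t, t') ∈ C →
      extendColors l₀ κ t ≠ extendColors l₀ κ t' := by
    intro κ hκ t t' htt ht ht' hmem
    have h1 := (Finset.mem_filter.1 hκ).2 (⟨t, ht⟩, ⟨t', ht'⟩) (by
      simp only [hCf, Finset.mem_filter, Finset.mem_univ, true_and]
      exact ⟨fun h2 => htt (congrArg Fin.val h2), hmem⟩)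
    simpa [extendColors, ht, ht'] using h1
  have hcount : ∀ κ ∈ K', (Fintype.card (I → Equiv.Perm L) * F.pin (F.dense h)) * (1 - δ) ≤
      ((Finset.univ.filter fun ω => F.Consistent T (extendColors l₀ κ) h ω).card : ℝ) := by
    intro κ hκ
    -- The known vertices of a block need different colours, otherwise no permutation has the
    -- prescribed values.
    have hinj : ∀ i, Set.InjOn
        (fun l => extendColors l₀ κ ((F.comp h (F.E (i, l))).getD 0))
        (F.labelsIn (F.dense h) i) := by
      intro i l hl l' hl' hll
      rw [Finset.mem_coe, mem_labelsIn, mem_dense] at hl hl'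
      obtain ⟨t, ht⟩ := Option.ne_none_iff_exists'.1 hl
      obtain ⟨t', ht'⟩ := Option.ne_none_iff_exists'.1 hl'
      by_contra hne
      simp only [ht, ht', Option.getD_some] at hll
      refine hsep κ hκ t t' ?_ (comp_lt ht) (comp_lt ht') (hCblock i l l' t t' ht ht' hne) hll
      rintro rfl
      exact hne (hh.label_unique ht ht')
    have h1 := le_card_pinnedFamilies_filter hinj T (F.plainLabels h) (by
      intro p hp hp'
      rw [mem_labelsIn, mem_dense] at hp'
      exact hp' (Finset.mem_filter.1 hp).2.2) (b := b)
      (fun i => ((hh.card_labelsIn_dense_le i).trans (edgeCount_le_length h)).trans hb) hbL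
    rw [card_pinnedFamilies hinj] at h1
    refine le_trans ?_ (h1.trans ?_)
    · refine mul_le_mul_of_nonneg_left ?_ ?_
      · have h2 : ((F.plainLabels h).card : ℝ) * T.card / (Fintype.card L - b : ℕ) ≤ δ := by
          rw [div_le_iff₀ hLb]
          refine le_trans ?_ hδb
          have h3 : (F.plainLabels h).card ≤ 2 * b := card_plainLabels_le.trans (by omega)
          gcongr
          exact_mod_cast h3
        linarith
      · exact mul_nonneg (by positivity)
          (Finset.prod_nonneg fun i _ => by positivity)
    · norm_cast
      refine Finset.card_le_card ?_
      intro ω hω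
      rw [Finset.mem_filter] at hω
      refine Finset.mem_filter.2 ⟨Finset.mem_univ _, consistent_of_mem hh ?_ ?_ hω.1 hω.2⟩
      · intro t ht
        have h2 := Fintype.mem_piFinset.1 (Finset.mem_filter.1 hκ).1 ⟨t, ht⟩
        have ht' : t < e := ht
        simpa [extendColors, ht'] using h2
      · intro p hp x y hxy t t' hx hy htt
        exact hsep κ hκ t t' htt (comp_lt hx) (comp_lt hy) (hCpairs p hp x y hxy t t' hx hy htt)
  have hω : ∀ ω : I → Equiv.Perm L, ENNReal.ofReal (F.weight h * τ ^ e *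
      (K'.filter fun κ => F.Consistent T (extendColors l₀ κ) h ω).card) ≤
      lik (F.graph T ω) h := by
    intro ω
    rcases (K'.filter fun κ => F.Consistent T (extendColors l₀ κ) h ω).eq_empty_or_nonempty with
      h0 | ⟨κ, hκ⟩
    · simp [h0]
    · have h1 : (K'.filter fun κ => F.Consistent T (extendColors l₀ κ) h ω).card ≤ 1 := by
        rw [Finset.card_le_one]
        intro κ₁ hκ₁ κ₂ hκ₂
        exact Consistent.colors_unique hh (Finset.mem_filter.1 hκ₁).2 (Finset.mem_filter.1 hκ₂).2
      refine le_trans (ENNReal.ofReal_le_ofReal ?_)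
        (weight_le_lik hh (Finset.mem_filter.1 hκ).2 hτ0 (hτ ω))
      refine mul_le_of_le_one_right (mul_nonneg (weight_nonneg h) (by positivity)) ?_
      exact_mod_cast h1
  have hswap : ∑ ω : I → Equiv.Perm L,
      ((K'.filter fun κ => F.Consistent T (extendColors l₀ κ) h ω).card : ℝ) =
      ∑ κ ∈ K', ((Finset.univ.filter fun ω =>
        F.Consistent T (extendColors l₀ κ) h ω).card : ℝ) := by
    simp only [Finset.card_filter, Nat.cast_sum]
    exact Finset.sum_comm
  have hpin : 0 ≤ F.pin (F.dense h) := Finset.prod_nonneg fun i _ => by positivity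
  rw [tsum_fintype]
  refine le_trans ?_ (Finset.sum_le_sum fun ω _ => hω ω)
  rw [← ENNReal.ofReal_sum_of_nonneg fun ω _ => mul_nonneg (mul_nonneg (weight_nonneg h)
    (by positivity)) (by positivity), ← Finset.mul_sum, hswap]
  apply ENNReal.ofReal_le_ofReal
  have hw := weight_nonneg (F := F) h
  have hδ0 : 0 ≤ 1 - δ := by linarith
  rw [ref, if_pos hh]
  set N : ℝ := Fintype.card (I → Equiv.Perm L) * F.pin (F.dense h) with hN
  have hN0 : 0 ≤ N := by positivity
  calc (1 - δ) ^ 3 * Fintype.card (I → Equiv.Perm L) * (F.weight h * F.pin (F.dense h))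
      = F.weight h * (1 - δ) * ((1 - δ) * (N * (1 - δ))) := by rw [hN]; ring
    _ ≤ F.weight h * (T.card * τ) ^ e * ((1 - δ) * (N * (1 - δ))) := by gcongr
    _ = F.weight h * τ ^ e * ((T.card ^ e * (1 - δ)) * (N * (1 - δ))) := by rw [mul_pow]; ring
    _ ≤ F.weight h * τ ^ e * (K'.card * (N * (1 - δ))) := by gcongr
    _ = F.weight h * τ ^ e * ∑ _κ ∈ K', N * (1 - δ) := by rw [Finset.sum_const, nsmul_eq_mul]
    _ ≤ _ := by
        gcongr with κ hκ
        exact hcount κ hκ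

end AverageLikelihood

end Frame

namespace Frame

/-! ### Near-normalization of the reference weights: edges and neighbours -/

section Normalization

open scoped Classical

variable {V I L : Type} [Fintype V] [Fintype I] [Fintype L] {F : Frame V I L} {wide : Prop}
  {h : History V} {u : Query V} {a : Answer V}

/-- The fraction of fresh vertices among the vertices of the block `i` which are not known to be in
a clique. -/
noncomputable def freshRatio (F : Frame V I L) (wide : Prop) (h : History V) (i : I) : ℝ :=
  (Finset.univ.filter fun l => F.Fresh wide h (F.E (i, l))).card /
    (Fintype.card L - (F.labelsIn (F.dense h) i).card : ℕ)

omit [Fintype I] in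
lemma freshRatio_nonneg (i : I) : 0 ≤ F.freshRatio wide h i := by
  unfold freshRatio; positivity

omit [Fintype I] in
lemma freshRatio_le_one (i : I) : F.freshRatio wide h i ≤ 1 := by
  unfold freshRatio
  refine div_le_one_of_le₀ ?_ (by positivity)
  norm_cast
  rw [← Finset.card_compl]
  refine Finset.card_le_card fun l hl => ?_
  rw [Finset.mem_compl, mem_labelsIn, mem_dense, not_not]
  exact (Finset.mem_filter.1 hl).2.2.1

lemma pin_nonneg (D : Finset V) : 0 ≤ F.pin D := Finset.prod_nonneg fun i _ => by positivity

/-- Given the pinned labels of its block, a further one has the prescribed colour with probability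
one over the number of labels left. -/
lemma pin_insert {D : Finset V} {i : I} {l : L} (hl : F.E (i, l) ∉ D) :
    F.pin (insert (F.E (i, l)) D) =
      F.pin D * ((Fintype.card L - (F.labelsIn D i).card : ℕ) : ℝ)⁻¹ := by
  have h1 : F.labelsIn (insert (F.E (i, l)) D) i = insert l (F.labelsIn D i) := by
    ext l'
    simp [mem_labelsIn]
  have h2 : ∀ j, j ≠ i → F.labelsIn (insert (F.E (i, l)) D) j = F.labelsIn D j := by
    intro j hj
    ext l'
    simp [mem_labelsIn, hj]
  rw [pin, pin, Fintype.prod_eq_mul_prod_compl i,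
    Fintype.prod_eq_mul_prod_compl i (fun j => _⁻¹), h1,
    Finset.card_insert_of_notMem (by rwa [mem_labelsIn]), Nat.descFactorial_succ]
  rw [Finset.prod_congr rfl (g := fun j =>
    ((Fintype.card L).descFactorial (F.labelsIn D j).card : ℝ)⁻¹)]
  · push_cast
    rw [mul_inv]
    ring
  · intro j hj
    rw [Finset.mem_compl, Finset.mem_singleton] at hj
    rw [h2 j hj]

lemma ref_cons (hh : F.Valid wide h) (hp : F.Possible wide h u a) :
    F.ref wide ((u, a) :: h) = F.stepWeight h u * F.weight h *
      F.pin (F.newLabels (F.comp h) u a ∪ F.dense h) := by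
  rw [ref, if_pos ⟨hh, hp⟩, dense_cons, weight]

lemma ref_cons_of_newLabels_eq_empty (hh : F.Valid wide h)
    (hn : F.newLabels (F.comp h) u a = ∅) (hs : F.Spec h u a) :
    F.ref wide ((u, a) :: h) = F.stepWeight h u * F.ref wide h := by
  have hp : F.Possible wide h u a :=
    ⟨by simp [hn], by simp [hn], by simp [hn], hs⟩
  rw [ref_cons hh hp, hn, Finset.empty_union, ref, if_pos hh, mul_assoc]

lemma ref_nonneg (h : History V) : 0 ≤ F.ref wide h := by
  unfold ref
  split_ifs
  · exact mul_nonneg (weight_nonneg h) (pin_nonneg _)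
  · rfl

/-- Only a lower bound for the total weight is needed, so some family of distinct answers may stand
for all answers. -/
lemma ofReal_sum_ref_le_tsum {ι : Type} (S : Finset ι) (f : ι → Answer V)
    (hf : Set.InjOn f S) :
    ENNReal.ofReal (∑ s ∈ S, F.ref wide ((u, f s) :: h)) ≤
      ∑' a, ENNReal.ofReal (F.ref wide ((u, a) :: h)) := by
  rw [ENNReal.ofReal_sum_of_nonneg fun s _ => ref_nonneg _,
    ← Finset.sum_image (f := fun a => ENNReal.ofReal (F.ref wide ((u, a) :: h))) hf]
  exact ENNReal.sum_le_tsum _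

/-- For answers that reveal no new clique vertex: `pin` does not change and only the step weights
have to add up to 1. -/
lemma ofReal_ref_le_tsum_of_newLabels_eq_empty (hh : F.Valid wide h) {ι : Type} (S : Finset ι)
    (f : ι → Answer V) (hf : Set.InjOn f S)
    (hn : ∀ s ∈ S, F.newLabels (F.comp h) u (f s) = ∅) (hs : ∀ s ∈ S, F.Spec h u (f s))
    (hw : 1 ≤ S.card * F.stepWeight h u) :
    ENNReal.ofReal (F.ref wide h) ≤ ∑' a, ENNReal.ofReal (F.ref wide ((u, a) :: h)) := by
  refine le_trans (ENNReal.ofReal_le_ofReal ?_) (ofReal_sum_ref_le_tsum S f hf)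
  rw [Finset.sum_congr rfl fun s hs' =>
    ref_cons_of_newLabels_eq_empty hh (hn s hs') (hs s hs'), Finset.sum_const, nsmul_eq_mul,
    ← mul_assoc]
  exact le_mul_of_one_le_left (ref_nonneg _) hw

lemma ref_randEdge (hh : F.Valid wide h) {p p' : I × L} (hpp : p.1 ≠ p'.1)
    (hp : F.Fresh wide h (F.E p)) (hp' : F.Fresh wide h (F.E p')) :
    F.ref wide ((Query.randEdge, Answer.edge s(F.E p, F.E p')) :: h) =
      F.stepWeight h .randEdge * F.ref wide h *
        (((Fintype.card L - (F.labelsIn (F.dense h) p.1).card : ℕ) : ℝ)⁻¹ *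
          ((Fintype.card L - (F.labelsIn (F.dense h) p'.1).card : ℕ) : ℝ)⁻¹) := by
  have hne : p ≠ p' := fun e => hpp (e ▸ rfl)
  have hnew : F.newLabels (F.comp h) .randEdge (Answer.edge s(F.E p, F.E p')) =
      {F.E p, F.E p'} := by
    ext v
    simp only [newLabels, Sym2.mem_iff, Finset.mem_filter, Finset.mem_univ, true_and,
      Finset.mem_insert, Finset.mem_singleton, and_iff_left_iff_imp]
    rintro (rfl | rfl)
    · exact hp.2.1
    · exact hp'.2.1
  have hposs : F.Possible wide h .randEdge (Answer.edge s(F.E p, F.E p')) := by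
    refine ⟨?_, ?_, ?_, ⟨F.E p, F.E p', F.E.injective.ne hne, rfl, hp.2.1, hp'.2.1⟩⟩
    · rw [hnew]
      simp [hp, hp']
    · rw [hnew]
      intro v hv
      have : ∀ w, F.comp h w ≠ some (target (F.comp h) (edgeCount h) .randEdge) := by
        intro w hw
        exact lt_irrefl _ (comp_lt hw)
      rw [Finset.mem_insert, Finset.mem_singleton] at hv
      rcases hv with rfl | rfl
      · exact ⟨p.1, p.2, rfl, fun l' => this _⟩
      · exact ⟨p'.1, p'.2, rfl, fun l' => this _⟩
    · rw [hnew]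
      intro i l l' hl hl'
      simp only [Finset.mem_insert, Finset.mem_singleton, F.E.injective.eq_iff] at hl hl'
      rcases hl with rfl | rfl <;> rcases hl' with h1 | h1
      · exact (congrArg Prod.snd h1).symm
      · exact absurd (by rw [← h1]) hpp
      · exact absurd (by rw [← h1]) hpp
      · exact (congrArg Prod.snd h1).symm
  have h1 : F.E p' ∉ F.dense h := by rw [mem_dense, not_not]; exact hp'.2.1
  have h2 : F.E p ∉ insert (F.E p') (F.dense h) := by
    rw [Finset.mem_insert, mem_dense, not_or, not_not]
    exact ⟨F.E.injective.ne hne, hp.2.1⟩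
  have h3 : F.labelsIn (insert (F.E p') (F.dense h)) p.1 = F.labelsIn (F.dense h) p.1 := by
    ext l
    rw [mem_labelsIn, mem_labelsIn, Finset.mem_insert, F.E.injective.eq_iff, or_iff_right]
    intro h4
    exact hpp (by rw [← h4])
  rw [ref_cons hh hposs, hnew, Finset.insert_union, Finset.singleton_union]
  rw [pin_insert (i := p.1) (l := p.2) h2, h3, pin_insert (i := p'.1) (l := p'.2) h1, ref,
    if_pos hh]
  ring

/-- Sum `r i * r j ≥ 1 - (1 - r i) - (1 - r j)` over ordered pairs; each index occurs in `2 * (|I| -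
1)` of them. -/
lemma le_sum_sum_erase_mul (r : I → ℝ) (hr1 : ∀ i, r i ≤ 1) {lam : ℝ}
    (hr : ∑ i, (1 - r i) ≤ lam) (hI : 2 ≤ Fintype.card I) :
    (Fintype.card I : ℝ) * (Fintype.card I - 1) - 2 * (Fintype.card I - 1) * lam ≤
      ∑ i, ∑ j ∈ Finset.univ.erase i, r i * r j := by
  have hI' : (2 : ℝ) ≤ Fintype.card I := by exact_mod_cast hI
  have hcard : ∀ i : I, ((Finset.univ.erase i).card : ℝ) = Fintype.card I - 1 := by
    intro i
    rw [Finset.card_erase_of_mem (Finset.mem_univ i), Finset.card_univ, Nat.cast_sub (by omega)]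
    simp
  have h1 : ∑ i, ∑ j ∈ Finset.univ.erase i, (1 - (1 - r i) - (1 - r j)) ≤
      ∑ i, ∑ j ∈ Finset.univ.erase i, r i * r j := by
    refine Finset.sum_le_sum fun i _ => Finset.sum_le_sum fun j _ => ?_
    nlinarith [mul_nonneg (sub_nonneg.2 (hr1 i)) (sub_nonneg.2 (hr1 j))]
  refine le_trans ?_ h1
  have h2 : ∑ i, ∑ j ∈ Finset.univ.erase i, (1 - (1 - r i) - (1 - r j)) =
      (Fintype.card I : ℝ) * (Fintype.card I - 1) -
        2 * (Fintype.card I - 1) * ∑ i, (1 - r i) := by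
    have h3 : ∀ i, ∑ j ∈ Finset.univ.erase i, (1 - (1 - r i) - (1 - r j)) =
        (Fintype.card I - 1) - (Fintype.card I - 1) * (1 - r i) -
          (∑ j, (1 - r j) - (1 - r i)) := by
      intro i
      rw [Finset.sum_sub_distrib, Finset.sum_const, nsmul_eq_mul, hcard,
        Finset.sum_erase_eq_sub (Finset.mem_univ i)]
      ring
    have h4 : ∑ i, r i = Fintype.card I - ∑ i, (1 - r i) := by simp
    generalize ∑ i, (1 - r i) = A at h3 h4 ⊢
    simp only [h3, Finset.sum_sub_distrib, ← Finset.mul_sum, Finset.sum_const, Finset.card_univ,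
      nsmul_eq_mul, h4]
    ring
  rw [h2]
  have : 0 ≤ 2 * ((Fintype.card I : ℝ) - 1) := by linarith
  nlinarith

/-- Each edge comes from at most two ordered pairs, hence the division by 2. -/
lemma sum_ref_randEdge_le_tsum (O : Finset ((I × L) × (I × L))) :
    ENNReal.ofReal ((∑ p ∈ O,
      F.ref wide ((Query.randEdge, Answer.edge s(F.E p.1, F.E p.2)) :: h)) / 2) ≤
      ∑' a, ENNReal.ofReal (F.ref wide ((Query.randEdge, a) :: h)) := by
  refine le_trans (ENNReal.ofReal_le_ofReal ?_) (ofReal_sum_ref_le_tsum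
    (O.image fun p => s(F.E p.1, F.E p.2)) Answer.edge
    (fun e _ e' _ he => Answer.edge.inj he))
  rw [div_le_iff₀ two_pos, ← Finset.sum_fiberwise_of_maps_to (s := O)
    (t := O.image fun p => s(F.E p.1, F.E p.2)) (g := fun p => s(F.E p.1, F.E p.2))
    (fun p hp => Finset.mem_image_of_mem _ hp), Finset.sum_mul]
  refine Finset.sum_le_sum fun e he => ?_
  rw [Finset.sum_congr rfl (g := fun _ => F.ref wide ((Query.randEdge, Answer.edge e) :: h))
    (fun p hp => by rw [(Finset.mem_filter.1 hp).2]), Finset.sum_const, nsmul_eq_mul, mul_comm]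
  refine mul_le_mul_of_nonneg_left ?_ (ref_nonneg _)
  obtain ⟨p, hp, rfl⟩ := Finset.mem_image.1 he
  have hsub : (O.filter fun p' => s(F.E p'.1, F.E p'.2) = s(F.E p.1, F.E p.2)) ⊆
      {p, (p.2, p.1)} := by
    intro p' hp'
    have h1 := (Finset.mem_filter.1 hp').2
    rw [Sym2.eq_iff, F.E.injective.eq_iff, F.E.injective.eq_iff, F.E.injective.eq_iff,
      F.E.injective.eq_iff] at h1
    rw [Finset.mem_insert, Finset.mem_singleton]
    rcases h1 with h1 | h1
    · exact Or.inl (Prod.ext h1.1 h1.2)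
    · exact Or.inr (Prod.ext h1.1 h1.2)
  exact_mod_cast (Finset.card_le_card hsub).trans Finset.card_le_two

/-- Both endpoints must be fresh; averaged over pairs of different blocks, this loses at most `2 *
lam / |I|`. -/
lemma ref_le_tsum_randEdge (hh : F.Valid wide h) (hI : 2 ≤ Fintype.card I) {lam δ : ℝ}
    (hlam : ∑ i, (1 - F.freshRatio wide h i) ≤ lam) (hδ : 2 + 2 * lam ≤ δ * Fintype.card I) :
    ENNReal.ofReal ((1 - δ) * F.ref wide h) ≤
      ∑' a, ENNReal.ofReal (F.ref wide ((Query.randEdge, a) :: h)) := by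
  let fr : I → Finset L := fun i => Finset.univ.filter fun l => F.Fresh wide h (F.E (i, l))
  let φ : I → ℝ := fun i => ((Fintype.card L - (F.labelsIn (F.dense h) i).card : ℕ) : ℝ)⁻¹
  let O : Finset ((I × L) × (I × L)) := Finset.univ.filter fun p =>
    p.1.1 ≠ p.2.1 ∧ F.Fresh wide h (F.E p.1) ∧ F.Fresh wide h (F.E p.2)
  refine le_trans (ENNReal.ofReal_le_ofReal ?_) (sum_ref_randEdge_le_tsum O)
  have h1 : ∑ p ∈ O, F.ref wide ((Query.randEdge, Answer.edge s(F.E p.1, F.E p.2)) :: h) =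
      F.stepWeight h .randEdge * F.ref wide h * ∑ p ∈ O, φ p.1.1 * φ p.2.1 := by
    rw [Finset.mul_sum]
    refine Finset.sum_congr rfl fun p hp => ?_
    have hp := (Finset.mem_filter.1 hp).2
    exact ref_randEdge hh hp.1 hp.2.1 hp.2.2
  have h2 : ∑ p ∈ O, φ p.1.1 * φ p.2.1 =
      ∑ i, ∑ j ∈ Finset.univ.erase i, F.freshRatio wide h i * F.freshRatio wide h j := by
    have hr : ∀ i, F.freshRatio wide h i = ∑ l, if F.Fresh wide h (F.E (i, l)) then φ i else 0 := by
      intro i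
      rw [← Finset.sum_filter, Finset.sum_const, nsmul_eq_mul]
      rfl
    rw [Finset.sum_filter]
    simp only [Fintype.sum_prod_type]
    refine Finset.sum_congr rfl fun i _ => ?_
    rw [Finset.sum_comm, ← Finset.sum_erase (a := i) (Finset.univ)
      (f := fun j => ∑ l, ∑ l', _) (by simp)]
    refine Finset.sum_congr rfl fun j hj => ?_
    have hij : i ≠ j := (Finset.ne_of_mem_erase hj).symm
    rw [hr, hr, Finset.sum_mul_sum]
    refine Finset.sum_congr rfl fun l _ => Finset.sum_congr rfl fun l' _ => ?_
    simp only [ne_eq, hij, not_false_eq_true, true_and, ite_and, ite_mul, mul_ite, zero_mul,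
      mul_zero]
    split_ifs <;> rfl
  have h3 := le_sum_sum_erase_mul (F.freshRatio wide h) freshRatio_le_one hlam hI
  have hI' : (2 : ℝ) ≤ Fintype.card I := by exact_mod_cast hI
  rw [h1, h2, mul_right_comm, mul_div_right_comm]
  refine mul_le_mul_of_nonneg_right ?_ (ref_nonneg _)
  have hpos : (0 : ℝ) < Fintype.card I * (Fintype.card I - 1) := by
    apply mul_pos <;> linarith
  rw [stepWeight, div_mul_eq_mul_div, div_div, le_div_iff₀ (by positivity)]
  nlinarith [mul_le_mul_of_nonneg_right hδ (show (0 : ℝ) ≤ Fintype.card I - 1 by linarith)]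

/-- The labels `l` such that the vertex in the block `j` of the component `t` may have the
label `l`. -/
noncomputable def choices (F : Frame V I L) (wide : Prop) (h : History V) (t : ℕ) (j : I) :
    Finset L :=
  if ∃ l, F.comp h (F.E (j, l)) = some t then
    Finset.univ.filter fun l => F.comp h (F.E (j, l)) = some t
  else Finset.univ.filter fun l => F.Fresh wide h (F.E (j, l))

/-- The weight of the choice of a vertex of the component `t` in the block `j`. -/
noncomputable def choiceWeight (F : Frame V I L) (h : History V) (t : ℕ) (j : I) : ℝ :=
  if ∃ l, F.comp h (F.E (j, l)) = some t then 1
  else ((Fintype.card L - (F.labelsIn (F.dense h) j).card : ℕ) : ℝ)⁻¹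

-- If the vertex of the component in the block is known, the choice is forced and has weight 1;
-- otherwise the weights of the fresh vertices add up to the fresh ratio.
omit [Fintype I] in
lemma freshRatio_le_card_choices_mul (t : ℕ) (j : I) :
    F.freshRatio wide h j ≤ (F.choices wide h t j).card * F.choiceWeight h t j := by
  unfold choices choiceWeight
  split_ifs with hk
  · rw [mul_one]
    obtain ⟨l, hl⟩ := hk
    refine freshRatio_le_one j |>.trans ?_
    exact_mod_cast Finset.card_pos.2 ⟨l, by simpa using hl⟩
  · exact le_of_eq rfl

lemma ref_randNbr (hh : F.Valid wide h) {x : V} {t : ℕ} (hx : F.comp h x = some t) {j : I} {l : L}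
    (hne : F.E (j, l) ≠ x) (hl : l ∈ F.choices wide h t j) :
    F.ref wide ((Query.randNbr x, Answer.vertex (F.E (j, l))) :: h) =
      F.stepWeight h (.randNbr x) * F.ref wide h * F.choiceWeight h t j := by
  by_cases hk : ∃ l, F.comp h (F.E (j, l)) = some t
  · rw [choices, if_pos hk] at hl
    have hl := (Finset.mem_filter.1 hl).2
    rw [choiceWeight, if_pos hk, mul_one]
    have hnew : F.newLabels (F.comp h) (.randNbr x) (Answer.vertex (F.E (j, l))) = ∅ := by
      rw [newLabels, Finset.filter_eq_empty_iff]
      rintro v - ⟨rfl, h1, -⟩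
      simp [hl] at h1
    refine ref_cons_of_newLabels_eq_empty hh hnew ⟨_, rfl, ?_⟩
    rw [if_neg (by simp [hx]), hx]
    exact ⟨hne, comp_cons_of_eq_some hl⟩
  · rw [choices, if_neg hk] at hl
    have hl := (Finset.mem_filter.1 hl).2
    rw [choiceWeight, if_neg hk]
    have hnew : F.newLabels (F.comp h) (.randNbr x) (Answer.vertex (F.E (j, l))) =
        {F.E (j, l)} := by
      ext v
      simp only [newLabels, Finset.mem_filter, Finset.mem_univ, true_and, Finset.mem_singleton,
        and_iff_left_iff_imp]
      rintro rfl
      exact ⟨hl.2.1, by simp [hx]⟩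
    have hposs : F.Possible wide h (.randNbr x) (Answer.vertex (F.E (j, l))) := by
      refine ⟨?_, ?_, ?_, ⟨_, rfl, ?_⟩⟩
      · rw [hnew]
        simpa using hl
      · rw [hnew]
        intro v hv
        rw [Finset.mem_singleton] at hv
        refine ⟨j, l, hv, fun l' hl' => hk ⟨l', ?_⟩⟩
        simpa [target, hx] using hl'
      · rw [hnew]
        intro i l₁ l₂ h1 h2
        rw [Finset.mem_singleton] at h1 h2
        have := F.E.injective (h1.trans h2.symm)
        simpa using this
      · rw [if_neg (by simp [hx]), comp_cons_of_mem (by rw [hnew]; simp)]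
        exact ⟨hne, by simp [target, hx]⟩
    rw [ref_cons hh hposs, hnew, Finset.singleton_union, pin_insert, ref, if_pos hh]
    · ring
    · rw [mem_dense, hl.2.1]
      simp

lemma ref_le_tsum_randNbr (hh : F.Valid wide h) (hI : 2 ≤ Fintype.card I) {lam δ : ℝ}
    (hlam : ∑ i, (1 - F.freshRatio wide h i) ≤ lam) (hδ : 2 + 2 * lam ≤ δ * Fintype.card I)
    (x : V) :
    ENNReal.ofReal ((1 - δ) * F.ref wide h) ≤
      ∑' a, ENNReal.ofReal (F.ref wide ((Query.randNbr x, a) :: h)) := by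
  have hI' : (2 : ℝ) ≤ Fintype.card I := by exact_mod_cast hI
  have hlam0 : 0 ≤ lam := le_trans
    (Finset.sum_nonneg fun i _ => sub_nonneg.2 (freshRatio_le_one i)) hlam
  have hδ0 : 0 ≤ δ := by
    by_contra hneg
    push Not at hneg
    nlinarith
  by_cases hn : F.comp h x = none
  · refine le_trans (ENNReal.ofReal_le_ofReal (mul_le_of_le_one_left (ref_nonneg _)
      (by linarith))) ?_
    refine ofReal_ref_le_tsum_of_newLabels_eq_empty hh (F.M.neighborFinset x) Answer.vertex
      (fun y _ y' _ hy => Answer.vertex.inj hy) ?_ ?_ ?_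
    · intro y _
      simp [newLabels, hn]
    · intro y hy
      rw [SimpleGraph.mem_neighborFinset] at hy
      exact ⟨y, rfl, by rwa [if_pos hn]⟩
    · rw [stepWeight, if_pos hn, SimpleGraph.card_neighborFinset_eq_degree]
      have := F.degree_pos x
      rw [mul_inv_cancel₀]
      exact_mod_cast this.ne'
  · obtain ⟨t, ht⟩ := Option.ne_none_iff_exists'.1 hn
    obtain ⟨i, l, rfl⟩ := hh.exists_eq_E hn
    refine le_trans (ENNReal.ofReal_le_ofReal ?_) (ofReal_sum_ref_le_tsum
      ((Finset.univ.erase i).sigma fun j => F.choices wide h t j)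
      (fun p => Answer.vertex (F.E (p.1, p.2))) ?_)
    · have h1 : ∀ p ∈ (Finset.univ.erase i).sigma fun j => F.choices wide h t j,
          F.ref wide ((Query.randNbr (F.E (i, l)), Answer.vertex (F.E (p.1, p.2))) :: h) =
          F.stepWeight h (.randNbr (F.E (i, l))) * F.ref wide h * F.choiceWeight h t p.1 := by
        intro p hp
        rw [Finset.mem_sigma] at hp
        refine ref_randNbr hh ht ?_ hp.2
        intro he
        have := F.E.injective he
        simp only [Prod.mk.injEq] at this
        exact Finset.ne_of_mem_erase hp.1 this.1
      rw [Finset.sum_congr rfl h1, ← Finset.mul_sum, Finset.sum_sigma, mul_right_comm]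
      refine mul_le_mul_of_nonneg_right ?_ (ref_nonneg _)
      rw [stepWeight, if_neg hn]
      -- The block of `x` is left out and the other blocks lose at most `lam`. After division by
      -- `|I| + 1` the loss is `(2 + lam) / (|I| + 1)`, which is at most `δ`.
      have h2 : (Fintype.card I : ℝ) - 1 - lam ≤
          ∑ j ∈ Finset.univ.erase i, ∑ _l ∈ F.choices wide h t j, F.choiceWeight h t j := by
        calc (Fintype.card I : ℝ) - 1 - lam ≤ ∑ j, F.freshRatio wide h j - 1 := by
              rw [Finset.sum_sub_distrib] at hlam
              simp only [Finset.sum_const, Finset.card_univ, nsmul_eq_mul, mul_one] at hlam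
              linarith
          _ ≤ ∑ j ∈ Finset.univ.erase i, F.freshRatio wide h j := by
              rw [Finset.sum_erase_eq_sub (Finset.mem_univ i)]
              have := freshRatio_le_one (F := F) (wide := wide) (h := h) i
              linarith
          _ ≤ _ := by
              refine Finset.sum_le_sum fun j _ => ?_
              rw [Finset.sum_const, nsmul_eq_mul]
              exact freshRatio_le_card_choices_mul t j
      rw [inv_mul_eq_div, le_div_iff₀ (by linarith)]
      nlinarith
    · rintro ⟨j, k⟩ - ⟨j', k'⟩ - he
      have := F.E.injective (Answer.vertex.inj he)
      simp only [Prod.mk.injEq] at this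
      rw [this.1, this.2]

end Normalization

end Frame

namespace Frame

/-! ### Near-normalization: full neighbourhoods and the summary -/

section Normalization

open scoped Classical

variable {V I L : Type} [Fintype V] [Fintype I] [Fintype L] {F : Frame V I L} {wide : Prop}
  {h : History V} {u : Query V} {a : Answer V}

/-- The neighborhood of a vertex `x` in a clique, if `f` gives the labels of the clique. -/
noncomputable def cliqueNbrs (F : Frame V I L) (x : V) (f : I → L) : Finset V :=
  F.M.neighborFinset x ∪ (Finset.univ.image fun i => F.E (i, f i)).erase x

lemma mem_choices_self (hh : F.Valid wide h) {i : I} {l l' : L} {t : ℕ}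
    (hx : F.comp h (F.E (i, l)) = some t) (hl : l' ∈ F.choices wide h t i) : l' = l := by
  rw [choices, if_pos ⟨l, hx⟩] at hl
  exact hh.label_unique (Finset.mem_filter.1 hl).2 hx

lemma newLabels_fullNbrHood (hh : F.Valid wide h) {i : I} {l : L} {t : ℕ}
    (hx : F.comp h (F.E (i, l)) = some t) {f : I → L} (hf : ∀ j, f j ∈ F.choices wide h t j) :
    F.newLabels (F.comp h) (.fullNbrHood (F.E (i, l)))
        (.vertices (F.cliqueNbrs (F.E (i, l)) f)) =
      Finset.univ.filter fun v => F.comp h v = none ∧ ∃ j, v = F.E (j, f j) := by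
  ext v
  simp only [newLabels, cliqueNbrs, Finset.mem_union, SimpleGraph.mem_neighborFinset,
    Finset.mem_erase, Finset.mem_image, Finset.mem_univ, true_and, Finset.mem_filter]
  constructor
  · rintro ⟨h1 | ⟨-, j, rfl⟩, h2, h3, -⟩
    · exact absurd h1 h2
    · exact ⟨h3, j, rfl⟩
  · rintro ⟨h1, j, rfl⟩
    have hne : F.E (j, f j) ≠ F.E (i, l) := by
      intro he
      rw [he, hx] at h1
      simp at h1
    refine ⟨Or.inr ⟨hne, j, rfl⟩, ?_, h1, by simp [hx]⟩
    -- A neighbour in `M` would lie in the block of the queried vertex, where the clique's only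
    -- vertex is the queried one.
    intro hadj
    obtain rfl := F.eq_of_adj hadj
    exact hne (by rw [mem_choices_self hh hx (hf i)])

/-- The blocks are independent: one where the clique is known contributes 1, any other gets one more
pinned label. -/
lemma ref_fullNbrHood (hh : F.Valid wide h) {i : I} {l : L} {t : ℕ}
    (hx : F.comp h (F.E (i, l)) = some t) {f : I → L} (hf : ∀ j, f j ∈ F.choices wide h t j) :
    F.ref wide ((Query.fullNbrHood (F.E (i, l)),
      Answer.vertices (F.cliqueNbrs (F.E (i, l)) f)) :: h) =
      F.ref wide h * ∏ j, F.choiceWeight h t j := by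
  have hnew := newLabels_fullNbrHood hh hx hf
  have htgt : target (F.comp h) (edgeCount h) (.fullNbrHood (F.E (i, l))) = t := by
    simp [target, hx]
  have hknown : ∀ j, (∃ l, F.comp h (F.E (j, l)) = some t) → F.comp h (F.E (j, f j)) = some t := by
    intro j hk
    have := hf j
    rw [choices, if_pos hk] at this
    exact (Finset.mem_filter.1 this).2
  have hunknown : ∀ j, (¬ ∃ l, F.comp h (F.E (j, l)) = some t) →
      F.Fresh wide h (F.E (j, f j)) := by
    intro j hk
    have := hf j
    rw [choices, if_neg hk] at this
    exact (Finset.mem_filter.1 this).2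
  have hnone : ∀ j, F.comp h (F.E (j, f j)) = none → ¬ ∃ l, F.comp h (F.E (j, l)) = some t := by
    intro j h1 hk
    rw [hknown j hk] at h1
    simp at h1
  have hposs : F.Possible wide h (.fullNbrHood (F.E (i, l)))
      (.vertices (F.cliqueNbrs (F.E (i, l)) f)) := by
    refine ⟨?_, ?_, ?_, ?_⟩
    · rw [hnew]
      intro v hv
      obtain ⟨-, h1, j, rfl⟩ := Finset.mem_filter.1 hv
      exact hunknown j (hnone j h1)
    · rw [hnew, htgt]
      intro v hv
      obtain ⟨-, h1, j, rfl⟩ := Finset.mem_filter.1 hv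
      exact ⟨j, f j, rfl, fun l' hl' => hnone j h1 ⟨l', hl'⟩⟩
    · rw [hnew]
      have key : ∀ j k, F.E (j, k) ∈ Finset.univ.filter
          (fun v => F.comp h v = none ∧ ∃ j, v = F.E (j, f j)) → k = f j := by
        intro j k hk
        obtain ⟨-, -, j', h1⟩ := Finset.mem_filter.1 hk
        have h2 := F.E.injective h1
        simp only [Prod.mk.injEq] at h2
        rw [h2.2, h2.1]
      intro j k k' hk hk'
      rw [key j k hk, key j k' hk']
    · rw [Spec, if_neg (by simp [hx])]
      refine ⟨f, fun j => ?_, rfl⟩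
      by_cases h1 : F.comp h (F.E (j, f j)) = none
      · rw [comp_cons_of_mem, htgt, hx]
        rw [hnew]
        exact Finset.mem_filter.2 ⟨Finset.mem_univ _, h1, j, rfl⟩
      · have hk : ∃ l, F.comp h (F.E (j, l)) = some t := by
          by_contra hk
          exact h1 (hunknown j hk).2.1
        rw [comp_cons_of_eq_some (hknown j hk), hx]
  rw [ref_cons hh hposs, ref, if_pos hh,
    show F.stepWeight h (.fullNbrHood (F.E (i, l))) = 1 from rfl, one_mul, mul_assoc]
  congr 1
  rw [pin, pin, ← Finset.prod_mul_distrib]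
  refine Finset.prod_congr rfl fun j _ => ?_
  rw [choiceWeight]
  by_cases hk : ∃ l, F.comp h (F.E (j, l)) = some t
  · rw [if_pos hk, mul_one]
    congr 4
    ext k
    rw [mem_labelsIn, mem_labelsIn, Finset.mem_union, or_iff_right]
    rw [hnew]
    intro hm
    obtain ⟨-, h1, j', h2⟩ := Finset.mem_filter.1 hm
    have h3 := F.E.injective h2
    simp only [Prod.mk.injEq] at h3
    obtain ⟨rfl, rfl⟩ := h3
    exact hnone _ h1 hk
  · rw [if_neg hk]
    have h1 := (hunknown j hk).2.1
    have h2 : F.labelsIn (F.newLabels (F.comp h) (.fullNbrHood (F.E (i, l)))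
        (.vertices (F.cliqueNbrs (F.E (i, l)) f)) ∪ F.dense h) j =
        insert (f j) (F.labelsIn (F.dense h) j) := by
      ext k
      rw [mem_labelsIn, Finset.mem_union, Finset.mem_insert, mem_labelsIn, hnew]
      refine or_congr_left ?_
      rw [Finset.mem_filter]
      constructor
      · rintro ⟨-, -, j', h3⟩
        have h4 := F.E.injective h3
        simp only [Prod.mk.injEq] at h4
        rw [h4.2, h4.1]
      · rintro rfl
        exact ⟨Finset.mem_univ _, h1, j, rfl⟩
    rw [h2, Finset.card_insert_of_notMem, Nat.descFactorial_succ]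
    · push_cast
      rw [mul_inv, mul_comm]
    · rw [mem_labelsIn, mem_dense, h1]
      simp

omit [Fintype I] in
lemma one_sub_sum_le_prod (r : I → ℝ) (hr0 : ∀ i, 0 ≤ r i) (hr1 : ∀ i, r i ≤ 1) (s : Finset I) :
    1 - ∑ i ∈ s, (1 - r i) ≤ ∏ i ∈ s, r i := by
  induction s using Finset.induction_on with
  | empty => simp
  | insert i s hi ih =>
    rw [Finset.sum_insert hi, Finset.prod_insert hi]
    have h1 : ∏ i ∈ s, r i ≤ 1 := Finset.prod_le_one (fun i _ => hr0 i) (fun i _ => hr1 i)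
    nlinarith [mul_nonneg (sub_nonneg.2 (hr1 i)) (sub_nonneg.2 h1)]

/-- The answer chooses a vertex in all blocks at once, so the losses of the blocks add up without
being divided by `|I|`. This is why full neighbourhoods require a small `lam` itself. -/
lemma ref_le_tsum_fullNbrHood (hh : F.Valid wide h) {δ : ℝ} (hδ0 : 0 ≤ δ)
    (hδ : ∑ i, (1 - F.freshRatio wide h i) ≤ δ) (x : V) :
    ENNReal.ofReal ((1 - δ) * F.ref wide h) ≤
      ∑' a, ENNReal.ofReal (F.ref wide ((Query.fullNbrHood x, a) :: h)) := by
  by_cases hn : F.comp h x = none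
  · refine le_trans (ENNReal.ofReal_le_ofReal (mul_le_of_le_one_left (ref_nonneg _)
      (by linarith))) ?_
    refine ofReal_ref_le_tsum_of_newLabels_eq_empty hh {()}
      (fun _ => Answer.vertices (F.M.neighborFinset x)) (by simp) ?_ ?_ (by simp [stepWeight])
    · simp [newLabels, hn]
    · simp [Spec, hn]
  · obtain ⟨t, ht⟩ := Option.ne_none_iff_exists'.1 hn
    obtain ⟨i, l, rfl⟩ := hh.exists_eq_E hn
    refine le_trans (ENNReal.ofReal_le_ofReal ?_) (ofReal_sum_ref_le_tsum
      (Fintype.piFinset fun j => F.choices wide h t j)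
      (fun f => Answer.vertices (F.cliqueNbrs (F.E (i, l)) f)) ?_)
    · rw [Finset.sum_congr rfl fun f hf => ref_fullNbrHood hh ht (Fintype.mem_piFinset.1 hf),
        Finset.sum_const, nsmul_eq_mul, Fintype.card_piFinset, Nat.cast_prod, mul_left_comm,
        ← Finset.prod_mul_distrib, mul_comm]
      refine mul_le_mul_of_nonneg_left ?_ (ref_nonneg _)
      have h1 := one_sub_sum_le_prod (F.freshRatio wide h) freshRatio_nonneg freshRatio_le_one
        Finset.univ
      refine le_trans ?_ (h1.trans (Finset.prod_le_prod (fun j _ => freshRatio_nonneg j)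
        fun j _ => freshRatio_le_card_choices_mul t j))
      linarith
    · intro f hf f' hf' hff
      have hf := Fintype.mem_piFinset.1 (Finset.mem_coe.1 hf)
      have hf' := Fintype.mem_piFinset.1 (Finset.mem_coe.1 hf')
      have hS : F.cliqueNbrs (F.E (i, l)) f = F.cliqueNbrs (F.E (i, l)) f' :=
        Answer.vertices.inj hff
      funext j
      by_cases hj : j = i
      · subst hj
        rw [mem_choices_self hh ht (hf j), mem_choices_self hh ht (hf' j)]
      -- Outside the block of the queried vertex the answer contains no neighbours in `M`, so the
      -- labels can be read off from it.
      · have h1 : F.E (j, f j) ∈ F.cliqueNbrs (F.E (i, l)) f := by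
          refine Finset.mem_union_right _ (Finset.mem_erase.2 ⟨?_, ?_⟩)
          · rw [F.E.injective.ne_iff]
            exact fun he => hj (congrArg Prod.fst he)
          · exact Finset.mem_image_of_mem _ (Finset.mem_univ j)
        rw [hS, cliqueNbrs, Finset.mem_union, SimpleGraph.mem_neighborFinset, Finset.mem_erase,
          Finset.mem_image] at h1
        rcases h1 with h1 | ⟨-, j', -, h1⟩
        · exact absurd (F.eq_of_adj h1).symm hj
        · have h2 := F.E.injective h1
          simp only [Prod.mk.injEq] at h2
          rw [← h2.2, h2.1]

/-- The weights of the answers to each query almost add up to the weight of the history. -/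
lemma ref_le_tsum_ref (hI : 2 ≤ Fintype.card I) {lam δ : ℝ} (hV : 0 < Fintype.card V)
    (hlam : F.Valid wide h → ∑ i, (1 - F.freshRatio wide h i) ≤ lam)
    (hδ : 2 + 2 * lam ≤ δ * Fintype.card I) (hδ0 : 0 ≤ δ)
    (hfull : ∀ x, u = .fullNbrHood x → lam ≤ δ) :
    ENNReal.ofReal ((1 - δ) * F.ref wide h) ≤
      ∑' a, ENNReal.ofReal (F.ref wide ((u, a) :: h)) := by
  by_cases hh : F.Valid wide h
  swap
  · rw [ref, if_neg hh]
    simp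
  have hlam := hlam hh
  have hle : ENNReal.ofReal ((1 - δ) * F.ref wide h) ≤ ENNReal.ofReal (F.ref wide h) :=
    ENNReal.ofReal_le_ofReal (mul_le_of_le_one_left (ref_nonneg _) (by linarith))
  cases u with
  | randVert =>
    refine hle.trans (ofReal_ref_le_tsum_of_newLabels_eq_empty hh Finset.univ Answer.vertex
      (fun y _ y' _ hy => Answer.vertex.inj hy) (fun _ _ => rfl) (fun v _ => ⟨v, rfl⟩) ?_)
    rw [stepWeight, Finset.card_univ, mul_inv_cancel₀]
    exact_mod_cast hV.ne'
  | randEdge => exact ref_le_tsum_randEdge hh hI hlam hδ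
  | randNbr x => exact ref_le_tsum_randNbr hh hI hlam hδ x
  | degree x =>
    exact hle.trans (ofReal_ref_le_tsum_of_newLabels_eq_empty hh {()} (fun _ => _) (by simp)
      (fun _ _ => rfl) (fun _ _ => rfl) (by simp [stepWeight]))
  | pair x y =>
    exact hle.trans (ofReal_ref_le_tsum_of_newLabels_eq_empty hh {()} (fun _ => _) (by simp)
      (fun _ _ => rfl) (fun _ _ => rfl) (by simp [stepWeight]))
  | fullNbrHood x => exact ref_le_tsum_fullNbrHood hh hδ0 (hlam.trans (hfull x rfl)) x

end Normalization

end Frame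

namespace Frame

/-! ### Indistinguishability and the losses in the wide and narrow processes -/

section LowerBound

open scoped Classical

variable {V I L : Type} [Fintype V] [Fintype I] [Fintype L] {F : Frame V I L} {wide : Prop}
  {h : History V} {allowed : Set (Query V)}

/-- All pairs of different components in `C` have to have different colours if the components
known after the history `h` are cliques of the graph. -/
structure Conflicts (F : Frame V I L) (h : History V) (C : Finset (ℕ × ℕ)) : Prop where
  pairs : ∀ p ∈ h, ∀ x y, p.1 = Query.pair x y → ∀ t t', F.comp h x = some t →
    F.comp h y = some t' → t ≠ t' → (t, t') ∈ C
  blocks : ∀ i l l' t t', F.comp h (F.E (i, l)) = some t → F.comp h (F.E (i, l')) = some t' →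
    l ≠ l' → (t, t') ∈ C

/-- `k * e` is 1 minus `2n / (2n + ks)`, the part reserved for `M`. This is at most `1 / (20(q+1))`,
and Bernoulli's inequality bounds the power. -/
lemma tau_pow_bound {n k s q e : ℝ} {j : ℕ} (hn : 0 < n) (hks : 40 * (q + 1) * n ≤ k * s)
    (hq : 0 ≤ q) (hj : j ≤ q) (he : e = s / (2 * n + k * s)) :
    1 - 1 / 20 ≤ (k * e) ^ j := by
  have hks0 : 0 < k * s := lt_of_lt_of_le (by positivity) hks
  have h1 : k * e = 1 + -(2 * n / (2 * n + k * s)) := by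
    rw [he]
    field_simp
    ring
  have h2 : 2 * n / (2 * n + k * s) * (20 * (q + 1)) ≤ 1 := by
    rw [div_mul_eq_mul_div, div_le_one (by positivity)]
    linarith
  have h3 : 0 ≤ 2 * n / (2 * n + k * s) := by positivity
  have h4 : 2 * n / (2 * n + k * s) ≤ 1 := by
    rw [div_le_one (by positivity)]; linarith
  rw [h1]
  refine le_trans ?_ (one_add_mul_le_pow (by linarith) j)
  have h5 : (j : ℝ) * (2 * n / (2 * n + k * s)) ≤ q * (2 * n / (2 * n + k * s)) := by gcongr
  linarith

lemma mul_ref_le_tsum_lik {T : Finset L} {q : ℕ} (hq : h.length ≤ q) (hqL : q < Fintype.card L)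
    (hV : 0 < Fintype.card V)
    (hTL : 40 * q * T.card ≤ Fintype.card L - q)
    (hTI : 40 * (q + 1) * Fintype.card V ≤ T.card * (Fintype.card I * (Fintype.card I - 1)))
    (hC : F.Valid wide h → ∃ C, F.Conflicts h C ∧ 20 * C.card ≤ T.card) :
    ENNReal.ofReal ((19 / 20) ^ 3) * Fintype.card (I → Equiv.Perm L) *
      ENNReal.ofReal (F.ref wide h) ≤ ∑' ω, lik (F.graph T ω) h := by
  by_cases hh : F.Valid wide h
  swap
  · rw [ref, if_neg hh]
    simp
  obtain ⟨C, hC, hCT⟩ := hC hh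
  have hTpos : 0 < T.card := by
    by_contra h0
    have : T.card = 0 := by omega
    rw [this, zero_mul] at hTI
    have : 0 < 40 * (q + 1) * Fintype.card V := by positivity
    omega
  have hIpos : 1 ≤ Fintype.card I := by
    by_contra h0
    have : Fintype.card I = 0 := by omega
    rw [this, zero_mul, mul_zero] at hTI
    have : 0 < 40 * (q + 1) * Fintype.card V := by positivity
    omega
  have hVR : (0 : ℝ) < Fintype.card V := by exact_mod_cast hV
  have hTR : (0 : ℝ) < T.card := by exact_mod_cast hTpos
  set s : ℝ := Fintype.card I * (Fintype.card I - 1) with hs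
  have hs' : ((Fintype.card I * (Fintype.card I - 1) : ℕ) : ℝ) = s := by
    rw [hs, Nat.cast_mul, Nat.cast_sub hIpos, Nat.cast_one]
  have hs0 : 0 ≤ s := by rw [← hs']; positivity
  have hTI' : 40 * ((q : ℝ) + 1) * Fintype.card V ≤ T.card * s := by
    rw [← hs']; exact_mod_cast hTI
  -- `τ` is the share of one clique in the upper bound `2|V| + |T| s` for twice the number of edges,
  -- where `s = |I| (|I| - 1)`.
  have key := pow_three_mul_ref_le_tsum_lik (F := F) (T := T) (δ := 1 / 20)
    (τ := s / (2 * Fintype.card V + T.card * s)) hh (Finset.card_pos.1 hTpos) (by positivity)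
    (by
      intro ω
      have h1 := F.two_mul_card_edgeFinset_le T ω
      have h2 : (2 : ℝ) * (F.graph T ω).edgeFinset.card ≤ 2 * Fintype.card V + T.card * s := by
        rw [← hs']; exact_mod_cast h1
      rw [mul_right_comm, ← mul_div_assoc, div_le_iff₀ (by positivity), mul_comm]
      gcongr)
    hq hqL C hC.pairs hC.blocks (by norm_num)
    (by
      have : (20 : ℝ) * C.card ≤ T.card := by exact_mod_cast hCT
      linarith)
    (by
      have : (40 : ℝ) * q * T.card ≤ (Fintype.card L - q : ℕ) := by exact_mod_cast hTL
      linarith)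
    (tau_pow_bound hVR hTI' (Nat.cast_nonneg q)
      (by exact_mod_cast (edgeCount_le_length h).trans hq) rfl)
  refine le_trans (le_of_eq ?_) key
  rw [ENNReal.ofReal_mul (by positivity), ENNReal.ofReal_mul (by positivity),
    ENNReal.ofReal_natCast]
  norm_num

/-- A frame of suitable size contains graphs with different average degrees which cannot be told
apart with `q` queries. -/
theorem not_estimates {A : Algorithm V allowed} {q m K : ℕ} {c lam : ℝ} (hc : 1 ≤ c)
    (hK : 2 * c ^ 2 ≤ K) (hI : 2 ≤ Fintype.card I) (hqL : q < Fintype.card L)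
    (hlam : ∀ h, Reachable allowed q h → F.Valid wide h →
      ∑ i, (1 - F.freshRatio wide h i) ≤ lam)
    (hlamI : 40 * (1 + lam) * (q + 1) ≤ Fintype.card I)
    (hfull : ∀ x, Query.fullNbrHood x ∈ allowed → 20 * lam * (q + 1) ≤ 1)
    (hC : ∀ h, Reachable allowed q h → F.Valid wide h →
      ∃ C, F.Conflicts h C ∧ 20 * C.card ≤ m)
    (hmL : K * m ≤ Fintype.card L) (hTL : 40 * q * (K * m) ≤ Fintype.card L - q)
    (hTI : 40 * (q + 1) * Fintype.card V ≤ m * (Fintype.card I * (Fintype.card I - 1)))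
    (hV : 0 < Fintype.card V) : ¬ Estimates A q c := by
  intro hA
  have hK1 : 1 ≤ K := by
    have : (1 : ℝ) ≤ K := by nlinarith
    exact_mod_cast this
  have hmK : m ≤ K * m := Nat.le_mul_of_pos_left m hK1
  have : Nonempty V := Fintype.card_pos_iff.1 hV
  obtain ⟨T, -, hT⟩ := Finset.exists_subset_card_eq
    (show m ≤ (Finset.univ : Finset L).card from hmK.trans hmL)
  obtain ⟨T', -, hT'⟩ := Finset.exists_subset_card_eq
    (show K * m ≤ (Finset.univ : Finset L).card from hmL)
  have hVR : (0 : ℝ) < Fintype.card V := by exact_mod_cast hV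
  set y : ℝ := (m * (Fintype.card I * (Fintype.card I - 1) : ℕ) : ℝ) / Fintype.card V with hy
  have hy40 : 40 ≤ y := by
    rw [hy, le_div_iff₀ hVR]
    have h1 : 40 * 1 * Fintype.card V ≤ m * (Fintype.card I * (Fintype.card I - 1)) :=
      le_trans (by gcongr; omega) hTI
    exact_mod_cast h1
  set S : Set (Option ℝ) := {r | ∃ x, r = some x ∧ x ≤ c * (2 + y)} with hS
  set S' : Set (Option ℝ) := {r | ∃ x, r = some x ∧ K * y / c ≤ x} with hS'
  -- A common element would give `K * y ≤ c² * (2 + y)`, while `K * y ≥ 2 * c² * y` and `y ≥ 40`.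
  have hdisj : Disjoint S S' := by
    rw [Set.disjoint_left]
    rintro _ ⟨x, rfl, hx⟩ ⟨x', hxx, hx'⟩
    obtain rfl := Option.some.inj hxx
    have h1 := hx'.trans hx
    rw [div_le_iff₀ (by linarith)] at h1
    nlinarith [mul_le_mul_of_nonneg_right hK (show 0 ≤ y by linarith)]
  have hG : ∀ ω, 2 / 3 < (run (F.graph T ω) A q []).toOuterMeasure S := by
    intro ω
    refine lt_of_lt_of_le (hA _ (F.exists_adj T ω)) (MeasureTheory.measure_mono ?_)
    rintro _ ⟨x, rfl, hx⟩
    refine ⟨x, rfl, hx.2.trans ?_⟩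
    have := F.avgDegree_le T ω
    rw [hT] at this
    gcongr
  have hG' : ∀ ω, 2 / 3 < (run (F.graph T' ω) A q []).toOuterMeasure S' := by
    intro ω
    refine lt_of_lt_of_le (hA _ (F.exists_adj T' ω)) (MeasureTheory.measure_mono ?_)
    rintro _ ⟨x, rfl, hx⟩
    refine ⟨x, rfl, le_trans ?_ hx.1⟩
    have h1 := F.le_avgDegree T' ω
    rw [hT'] at h1
    have h2 : K * y = ((K * m : ℕ) * (Fintype.card I * (Fintype.card I - 1) : ℕ) : ℝ) /
        Fintype.card V := by
      rw [hy]; push_cast; ring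
    rw [h2]
    gcongr
  -- Chosen so that `q` queries lose at most `1/20` altogether.
  set δ : ℝ := (20 * (q + 1))⁻¹ with hδ
  have hδ0 : 0 < δ := by positivity
  have hδq : δ * (20 * (q + 1)) = 1 := inv_mul_cancel₀ (by positivity)
  have hδ1 : δ ≤ 1 := by
    have : (0 : ℝ) ≤ q := by positivity
    nlinarith
  have hres := not_estimates_of_reference (F.graph T) (F.graph T') A q hdisj hG hG'
    (fun h => ENNReal.ofReal (F.ref wide h))
    (by
      have : F.labelsIn ∅ = fun _ => ∅ := by
        funext i; ext l; simp [mem_labelsIn]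
      have h2 : F.dense [] = ∅ := by
        ext v; simp [mem_dense, comp]
      simp [ref, Valid, weight, h2, pin, this])
    (r := ENNReal.ofReal (1 - δ)) (r' := ENNReal.ofReal ((19 / 20) ^ 3))
    (ENNReal.ofReal_le_one.2 (by linarith))
    (by
      intro h hr _ u hu
      rw [← ENNReal.ofReal_mul (by linarith)]
      refine ref_le_tsum_ref hI hV (hlam h hr) ?_ hδ0.le ?_
      · have : δ * (40 * (1 + lam) * (q + 1)) ≤ δ * Fintype.card I := by gcongr
        nlinarith
      · rintro x rfl
        have h1 : δ * (20 * lam * (q + 1)) ≤ δ * 1 := by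
          gcongr
          exact hfull x hu
        nlinarith)
    (by
      intro h hr
      exact mul_ref_le_tsum_lik hr.1 hqL hV
        (le_trans (by rw [hT]; gcongr) hTL) (by rw [hT]; exact hTI) (by rw [hT]; exact hC h hr))
    (by
      intro h hr
      refine mul_ref_le_tsum_lik hr.1 hqL hV (by rw [hT']; exact hTL)
        (by rw [hT']; exact hTI.trans (by gcongr)) (fun hh => ?_)
      obtain ⟨C, h1, h2⟩ := hC h hr hh
      exact ⟨C, h1, by rw [hT']; exact h2.trans hmK⟩)
  rw [← ENNReal.ofReal_pow (by linarith), ← ENNReal.ofReal_mul (by positivity)] at hres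
  have h23 : (2 / 3 : ℝ≥0∞) = ENNReal.ofReal (2 / 3) := by
    rw [ENNReal.ofReal_div_of_pos (by norm_num)]
    simp
  rw [h23, ENNReal.ofReal_le_ofReal_iff (by norm_num)] at hres
  have hb : 1 + (q : ℝ) * (-δ) ≤ (1 + -δ) ^ q := one_add_mul_le_pow (by linarith) q
  have hqδ : (q : ℝ) * δ ≤ 1 / 20 := by nlinarith
  rw [← sub_eq_add_neg] at hb
  nlinarith

lemma card_labelsIn_compl_le (i : I) :
    (Fintype.card L - (F.labelsIn (F.dense h) i).card) ≤
      (Finset.univ.filter fun l => F.Fresh False h (F.E (i, l))).card +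
        ((F.plainLabels h).filter fun p => p.1 = i).card := by
  rw [← Finset.card_compl, ← Finset.card_image_of_injective _ (Prod.mk_right_injective i),
    ← Finset.card_image_of_injective (Finset.univ.filter _) (Prod.mk_right_injective i)]
  refine le_trans (Finset.card_le_card ?_) (Finset.card_union_le _ _)
  intro p hp
  obtain ⟨l, hl, rfl⟩ := Finset.mem_image.1 hp
  rw [Finset.mem_compl, mem_labelsIn, mem_dense, not_not] at hl
  rw [Finset.mem_union]
  by_cases hq : F.E (i, l) ∈ queried h
  · exact Or.inr (Finset.mem_filter.2 ⟨Finset.mem_filter.2 ⟨Finset.mem_univ _, hq, hl⟩, rfl⟩)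
  · exact Or.inl (Finset.mem_image_of_mem _ (Finset.mem_filter.2
      ⟨Finset.mem_univ _, hq, hl, False.elim⟩))

/-- In the narrow process freshness is lost only at plain labels. There are at most `2 * q` of them,
and each costs at most `1 / (|L| - q)`. -/
lemma sum_one_sub_freshRatio_le (hh : F.Valid False h) {q : ℕ} (hq : h.length ≤ q)
    (hqL : q < Fintype.card L) :
    ∑ i, (1 - F.freshRatio False h i) ≤ 2 * q / (Fintype.card L - q : ℕ) := by
  have hpos : (0 : ℝ) < (Fintype.card L - q : ℕ) := by exact_mod_cast Nat.sub_pos_of_lt hqL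
  have h1 : ∀ i, 1 - F.freshRatio False h i ≤
      (((F.plainLabels h).filter fun p => p.1 = i).card : ℝ) / (Fintype.card L - q : ℕ) := by
    intro i
    have hle : Fintype.card L - q ≤ Fintype.card L - (F.labelsIn (F.dense h) i).card :=
      Nat.sub_le_sub_left
        (((hh.card_labelsIn_dense_le i).trans (edgeCount_le_length h)).trans hq) _
    have hleR : ((Fintype.card L - q : ℕ) : ℝ) ≤
        (Fintype.card L - (F.labelsIn (F.dense h) i).card : ℕ) := by exact_mod_cast hle
    have hφ := lt_of_lt_of_le hpos hleR
    calc 1 - F.freshRatio False h i ≤ (((F.plainLabels h).filter fun p => p.1 = i).card : ℝ) /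
          (Fintype.card L - (F.labelsIn (F.dense h) i).card : ℕ) := by
          rw [freshRatio, sub_le_iff_le_add', ← add_div, le_div_iff₀ hφ, one_mul]
          exact_mod_cast card_labelsIn_compl_le (F := F) (h := h) i
      _ ≤ _ := by gcongr
  refine (Finset.sum_le_sum fun i _ => h1 i).trans ?_
  rw [← Finset.sum_div, ← Nat.cast_sum, ← Finset.card_eq_sum_card_fiberwise
    (f := Prod.fst) (s := F.plainLabels h) (t := Finset.univ)
    (fun _ _ => Finset.mem_coe.2 (Finset.mem_univ _))]
  gcongr
  have := card_plainLabels_le (F := F) (h := h)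
  exact_mod_cast this.trans (by omega)

omit [Fintype I] [Fintype L] in
lemma card_newLabels_le (c : V → Option ℕ) {u : Query V} (hu : ∀ x, u ≠ .fullNbrHood x)
    (a : Answer V) : (F.newLabels c u a).card ≤ 2 := by
  unfold newLabels
  split
  · rename_i e
    induction e using Sym2.ind with
    | _ x y =>
      refine (Finset.card_le_card (t := {x, y}) ?_).trans Finset.card_le_two
      intro v hv
      simpa using (Finset.mem_filter.1 hv).2.1
  · rename_i x y
    refine (Finset.card_le_card (t := {y}) ?_).trans (by simp)
    intro v hv
    simpa using (Finset.mem_filter.1 hv).2.1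
  · exact absurd rfl (hu _)
  · simp

omit [Fintype I] [Fintype L] in
lemma card_dense_le (hf : ∀ p ∈ h, ∀ x, p.1 ≠ .fullNbrHood x) :
    (F.dense h).card ≤ 2 * h.length := by
  induction h with
  | nil => simp [dense, comp]
  | cons p h ih =>
    obtain ⟨u, a⟩ := p
    rw [dense_cons, List.length_cons]
    have h1 := card_newLabels_le (F := F) (F.comp h) (u := u) (hf _ List.mem_cons_self) a
    have h2 := ih fun p hp => hf p (List.mem_cons_of_mem _ hp)
    have h3 := Finset.card_union_le (F.newLabels (F.comp h) u a) (F.dense h)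
    omega

/-- A touched block is written off entirely and an untouched one loses nothing; at most `2 * q`
queried and `2 * q` known clique vertices touch blocks. -/
lemma sum_one_sub_freshRatio_le_of_wide (hL : 0 < Fintype.card L)
    (hf : ∀ p ∈ h, ∀ x, p.1 ≠ .fullNbrHood x) {q : ℕ} (hq : h.length ≤ q) :
    ∑ i, (1 - F.freshRatio True h i) ≤ 4 * q := by
  let D : Finset I := Finset.univ.filter fun i => ∃ l, F.E (i, l) ∈ queried h ∪ F.dense h
  have hD : D.card ≤ 4 * q := by
    have h1 : D.card ≤ (queried h ∪ F.dense h).card := by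
      have : Nonempty L := Fintype.card_pos_iff.1 hL
      choose! f hf using fun i (hi : i ∈ D) => (Finset.mem_filter.1 hi).2
      refine Finset.card_le_card_of_injOn (fun i => F.E (i, f i)) hf ?_
      intro i _ j _ hij
      exact congrArg Prod.fst (F.E.injective hij)
    have h2 := Finset.card_union_le (queried h) (F.dense h)
    have h3 := card_queried_le h
    have h4 := card_dense_le hf (F := F)
    omega
  have h1 : ∀ i, 1 - F.freshRatio True h i ≤ if i ∈ D then 1 else 0 := by
    intro i
    split_ifs with hi
    · linarith [freshRatio_nonneg (F := F) (wide := True) (h := h) i]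
    · have hi' : ∀ l, F.E (i, l) ∉ queried h ∧ F.comp h (F.E (i, l)) = none := by
        intro l
        by_contra hc
        refine hi (Finset.mem_filter.2 ⟨Finset.mem_univ _, l, ?_⟩)
        rw [Finset.mem_union, mem_dense]
        tauto
      have h2 : F.labelsIn (F.dense h) i = ∅ := by
        ext l
        simp [mem_labelsIn, mem_dense, hi' l]
      have h3 : (Finset.univ.filter fun l => F.Fresh True h (F.E (i, l))) = Finset.univ := by
        refine Finset.filter_true_of_mem fun l _ => ⟨(hi' l).1, (hi' l).2, fun _ j k k' he => ?_⟩
        have := F.E.injective he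
        simp only [Prod.mk.injEq] at this
        rw [← this.1]
        exact hi' k'
      rw [freshRatio, h2, h3, Finset.card_univ, Finset.card_empty, Nat.sub_zero, div_self]
      · simp
      · exact_mod_cast hL.ne'
  refine (Finset.sum_le_sum fun i _ => h1 i).trans ?_
  rw [Finset.sum_ite_mem, Finset.univ_inter, Finset.sum_const, nsmul_eq_mul, mul_one]
  exact_mod_cast hD

-- No block holds two known clique vertices, so conflicts come only from pair queries, at most one
-- from each.
omit [Fintype L] in
lemma exists_conflicts_of_wide (hh : F.Valid True h) :
    ∃ C, F.Conflicts h C ∧ C.card ≤ h.length := by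
  let f : Query V × Answer V → ℕ × ℕ := fun p =>
    match p.1 with
    | .pair x y => ((F.comp h x).getD 0, (F.comp h y).getD 0)
    -- A harmless default, since only different components have to be separated.
    | _ => (0, 0)
  refine ⟨h.toFinset.image f, ⟨?_, ?_⟩, Finset.card_image_le.trans (List.toFinset_card_le h)⟩
  · rintro ⟨u, a⟩ hp x y hu t t' hx hy -
    simp only at hu
    subst hu
    refine Finset.mem_image.2 ⟨_, List.mem_toFinset.2 hp, ?_⟩
    simp [f, hx, hy]
  · intro i l l' t t' hl hl' hne
    exact absurd (hh.label_unique_of_wide (i := i) trivial (by simp [hl]) (by simp [hl'])) hne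

omit [Fintype L] in
lemma conflicts_empty_of_wide (hh : F.Valid True h) (hp : ∀ p ∈ h, ∀ x y, p.1 ≠ .pair x y) :
    F.Conflicts h ∅ where
  pairs p hph x y hu := absurd hu (hp p hph x y)
  blocks i l l' t t' hl hl' hne :=
    absurd (hh.label_unique_of_wide (i := i) trivial (by simp [hl]) (by simp [hl'])) hne

-- All pairs of component numbers are taken; this is what asks for `q ^ 2` in the narrow case.
omit [Fintype I] [Fintype L] in
lemma exists_conflicts {q : ℕ} (hq : h.length ≤ q) :
    ∃ C, F.Conflicts h C ∧ C.card ≤ q ^ 2 := by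
  have hlt : ∀ v t, F.comp h v = some t → t ∈ Finset.range q := fun v t hv =>
    Finset.mem_range.2 ((comp_lt hv).trans_le ((edgeCount_le_length h).trans hq))
  refine ⟨Finset.range q ×ˢ Finset.range q, ⟨?_, ?_⟩, ?_⟩
  · intro p _ x y _ t t' hx hy _
    exact Finset.mem_product.2 ⟨hlt _ _ hx, hlt _ _ hy⟩
  · intro i l l' t t' hl hl' _
    exact Finset.mem_product.2 ⟨hlt _ _ hl, hlt _ _ hl'⟩
  · simp [sq]

end LowerBound

end Frame

/-! ### A concrete frame -/

section ConcreteFrame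

/-- The pairs `{0, 1}, {2, 3}, …`, where the last one is enlarged to a triple if `n` is odd. -/
def pairing (n : ℕ) : SimpleGraph (Fin n) where
  Adj x y := x ≠ y ∧ min ((x : ℕ) / 2) (n / 2 - 1) = min ((y : ℕ) / 2) (n / 2 - 1)
  symm := ⟨fun _ _ h => ⟨h.1.symm, h.2.symm⟩⟩
  loopless := ⟨fun _ h => h.1 rfl⟩

lemma pairing_adj {n : ℕ} {x y : Fin n} : (pairing n).Adj x y ↔
    x ≠ y ∧ min ((x : ℕ) / 2) (n / 2 - 1) = min ((y : ℕ) / 2) (n / 2 - 1) := Iff.rfl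

/-- Consecutive blocks of vertices of even size. -/
def consecutiveBlocks {n s l : ℕ} (h : s * (2 * l) ≤ n) : Fin s × Fin (2 * l) ↪ Fin n where
  toFun p := ⟨p.1 * (2 * l) + p.2, by
    have h1 : ((p.1 : ℕ) + 1) * (2 * l) ≤ s * (2 * l) := Nat.mul_le_mul_right _ p.1.2
    have h2 := p.2.2
    rw [add_mul] at h1
    omega⟩
  inj' := by
    rintro ⟨i, k⟩ ⟨j, k'⟩ he
    simp only [Fin.mk.injEq] at he
    have hpos : 0 < 2 * l := lt_of_le_of_lt (Nat.zero_le _) k.2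
    have h1 : ∀ (i k : ℕ), k < 2 * l → (i * (2 * l) + k) / (2 * l) = i := by
      intro i k hk
      rw [add_comm, Nat.add_mul_div_right _ _ hpos, Nat.div_eq_of_lt hk, zero_add]
    have h2 : (i : ℕ) = j := by rw [← h1 i k k.2, he, h1 j k' k'.2]
    rw [h2] at he
    exact Prod.ext (Fin.ext h2) (Fin.ext (by simpa using he))

lemma consecutiveBlocks_div {n s l : ℕ} (h : s * (2 * l) ≤ n) (i : Fin s) (k : Fin (2 * l)) :
    (consecutiveBlocks h (i, k) : ℕ) / 2 / l = i ∧
      (consecutiveBlocks h (i, k) : ℕ) < s * (2 * l) := by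
  have hpos : 0 < 2 * l := lt_of_le_of_lt (Nat.zero_le _) k.2
  have hval : (consecutiveBlocks h (i, k) : ℕ) = i * (2 * l) + k := rfl
  constructor
  · rw [hval, Nat.div_div_eq_div_mul, add_comm, Nat.add_mul_div_right _ _ hpos,
      Nat.div_eq_of_lt k.2, zero_add]
  · have h1 : ((i : ℕ) + 1) * (2 * l) ≤ s * (2 * l) := Nat.mul_le_mul_right _ i.2
    have h2 := k.2
    rw [add_mul] at h1
    omega

/-- A frame with `s` blocks of size `2 * l`. -/
def frame {n s l : ℕ} (hn : 2 ≤ n) (h : s * (2 * l) ≤ n) :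
    Frame (Fin n) (Fin s) (Fin (2 * l)) where
  E := consecutiveBlocks h
  M := pairing n
  eq_of_adj := by
    intro i j k k' hadj
    have h1 := consecutiveBlocks_div h i k
    have h2 := consecutiveBlocks_div h j k'
    obtain ⟨-, h3⟩ := pairing_adj.1 hadj
    have h4 : s * (2 * l) = 2 * (s * l) := by ring
    -- The blocks cover an even number of vertices, so for odd `n` the extra vertex of the triple
    -- lies outside them and the minimum has no effect.
    have h5 : (consecutiveBlocks h (i, k) : ℕ) / 2 = (consecutiveBlocks h (j, k') : ℕ) / 2 := by
      omega
    rw [h5, h2.1] at h1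
    exact Fin.ext h1.1.symm
  degree_pos := by
    intro v
    rw [SimpleGraph.degree_pos_iff_exists_adj]
    have hv := v.2
    by_cases h1 : (v : ℕ) % 2 = 0 ∧ (v : ℕ) + 1 < n
    · refine ⟨⟨v + 1, h1.2⟩, pairing_adj.2 ⟨?_, ?_⟩⟩
      · intro he
        have := congrArg Fin.val he
        simp at this
      · simp only
        omega
    · refine ⟨⟨v - 1, by omega⟩, pairing_adj.2 ⟨?_, ?_⟩⟩
      · intro he
        have := congrArg Fin.val he
        simp only at this
        omega
      · simp only
        omega
  degree_le := by
    classical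
    intro v
    have hv := v.2
    rw [← SimpleGraph.card_neighborFinset_eq_degree]
    have hv' : (v : ℕ) ∈ Finset.Icc (2 * min ((v : ℕ) / 2) (n / 2 - 1))
        (2 * min ((v : ℕ) / 2) (n / 2 - 1) + 2) := by
      rw [Finset.mem_Icc]
      omega
    have hcard : ((Finset.Icc (2 * min ((v : ℕ) / 2) (n / 2 - 1))
        (2 * min ((v : ℕ) / 2) (n / 2 - 1) + 2)).erase (v : ℕ)).card = 2 := by
      rw [Finset.card_erase_of_mem hv', Nat.card_Icc]
      omega
    rw [← hcard]
    refine Finset.card_le_card_of_injOn Fin.val ?_ (fun _ _ _ _ he => Fin.ext he)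
    intro w hw
    rw [Finset.mem_coe, SimpleGraph.mem_neighborFinset, pairing_adj] at hw
    have hw' := w.2
    rw [Finset.mem_coe, Finset.mem_erase, Finset.mem_Icc]
    refine ⟨fun he => hw.1 (Fin.ext he.symm), ?_⟩
    obtain ⟨-, h3⟩ := hw
    omega

end ConcreteFrame

/-! ### Choice of the sizes -/

section Numbers

lemma half_le_floor {x : ℝ} (hx : 1 ≤ x) : x / 2 ≤ ⌊x⌋₊ := by
  have h1 := Nat.lt_floor_add_one x
  have h2 : (1 : ℝ) ≤ ⌊x⌋₊ := by exact_mod_cast (Nat.one_le_floor_iff x).2 hx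
  linarith

/-- With `s = ⌊a²⌋`, `m = ⌊a^k⌋` and `2 * l` about `a^(k+1)`, both `n / (m s²)` and `m / (2 * l)`
are of order `1/a`. All conditions then follow from `(q + 1) * 1000 * K ≤ a`; the large constant
absorbs the rounding. -/
lemma exists_sizes {n q K k : ℕ} {a : ℝ} (ha : a ^ (k + 3) = n) (hK : 1 ≤ K)
    (haK : 1000 * K ≤ a) (hq : ((q : ℝ) + 1) * (1000 * K) ≤ a) :
    ∃ s l m : ℕ, 2 ≤ s ∧ s * (2 * l) ≤ n ∧ q < 2 * l ∧ 200 * (q + 1) ^ 2 ≤ s ∧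
      K * m ≤ 2 * l ∧ 40 * q * (K * m) ≤ 2 * l - q ∧
      40 * (q + 1) * n ≤ m * (s * (s - 1)) ∧ (1 ≤ k → 20 * q ^ k ≤ m) ∧
      (1 ≤ k → 40 * q * (q + 1) ≤ 2 * l - q) := by
  have hKR : (1 : ℝ) ≤ K := by exact_mod_cast hK
  have ha1000 : 1000 ≤ a := by linarith
  have ha1 : 1 ≤ a := by linarith
  have ha0 : 0 < a := by linarith
  have hq0 : (0 : ℝ) ≤ q := Nat.cast_nonneg q
  have hq1000 : ((q : ℝ) + 1) * 1000 ≤ a := by nlinarith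
  have hak : 1 ≤ a ^ k := one_le_pow₀ ha1
  set b : ℝ := a ^ k with hb
  have hn : (n : ℝ) = b * a * a ^ 2 := by rw [← ha, hb]; ring
  set s := ⌊a ^ 2⌋₊ with hs
  have ha2 : 1 ≤ a ^ 2 := one_le_pow₀ ha1
  have hs1 : (s : ℝ) ≤ a ^ 2 := Nat.floor_le (by positivity)
  have hs2 : a ^ 2 - 1 < s := by have := Nat.lt_floor_add_one (a ^ 2); linarith
  have ha2' : 1000 * 1000 ≤ a ^ 2 := by nlinarith
  have hs3 : a ^ 2 / 2 ≤ s := by linarith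
  have hs0 : (0 : ℝ) < s := by linarith
  set m := ⌊b⌋₊ with hm
  have hm1 : (m : ℝ) ≤ b := Nat.floor_le (by positivity)
  have hm2 : b / 2 ≤ m := half_le_floor hak
  set l := n / (2 * s) with hl
  have hsl : s * (2 * l) ≤ n := by
    have := Nat.div_mul_le_self n (2 * s)
    calc s * (2 * l) = n / (2 * s) * (2 * s) := by rw [hl]; ring
      _ ≤ n := this
  have hl2 : b * a / 2 ≤ (2 * l : ℕ) := by
    have hs0' : 0 < 2 * s := by
      have : 0 < s := by exact_mod_cast hs0
      omega
    have h1 : n < 2 * s * (l + 1) := Nat.lt_mul_div_succ n hs0'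
    have h2 : (n : ℝ) < 2 * s * (l + 1) := by exact_mod_cast h1
    rw [hn] at h2
    have h3 : b * a * a ^ 2 < 2 * a ^ 2 * (l + 1) := by
      refine h2.trans_le ?_
      gcongr
    have h4 : b * a < 2 * (l + 1) := by
      refine lt_of_mul_lt_mul_right (a := a ^ 2) ?_ (by positivity)
      linarith
    have h5 : 4 ≤ b * a := by nlinarith
    push_cast
    linarith
  have hab : a ≤ b * a := by nlinarith
  have hqR : (q : ℝ) ≤ a / 1000 := by linarith
  have hql : q < 2 * l := by
    have : (q : ℝ) < (2 * l : ℕ) := by linarith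
    exact_mod_cast this
  have hqK : (q : ℝ) * K ≤ a / 1000 := by linarith
  refine ⟨s, l, m, ?_, hsl, hql, ?_, ?_, ?_, ?_, ?_, ?_⟩
  · have : (2 : ℝ) ≤ s := by linarith
    exact_mod_cast this
  · have : (200 : ℝ) * (q + 1) ^ 2 ≤ s := by
      have h1 : (((q : ℝ) + 1) * 1000) ^ 2 ≤ a ^ 2 := by gcongr
      have h2 : (0 : ℝ) ≤ (q + 1) ^ 2 := by positivity
      rw [mul_pow] at h1
      linarith
    exact_mod_cast this
  · have : (K : ℝ) * m ≤ (2 * l : ℕ) := by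
      refine le_trans ?_ hl2
      have h1 : (K : ℝ) * m ≤ K * b := by gcongr
      have h2 : (K : ℝ) * b ≤ a / 1000 * b := by gcongr; linarith
      linarith
    exact_mod_cast this
  · rw [Nat.le_sub_iff_add_le hql.le]
    have : (40 : ℝ) * q * (K * m) + q ≤ (2 * l : ℕ) := by
      refine le_trans ?_ hl2
      have h1 : (q : ℝ) * K * m ≤ a / 1000 * b := by gcongr
      linarith
    exact_mod_cast this
  · have hs1' : 1 ≤ s := by
      have : (1 : ℝ) ≤ s := by linarith
      exact_mod_cast this
    have : (40 : ℝ) * (q + 1) * n ≤ m * (s * (s - 1 : ℕ)) := by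
      rw [Nat.cast_sub hs1', Nat.cast_one, hn]
      have h1 : b / 2 * (a ^ 2 / 2 * (a ^ 2 / 4)) ≤ m * (s * ((s : ℝ) - 1)) := by
        gcongr
        linarith
      refine le_trans ?_ h1
      have h2 : ((q : ℝ) + 1) * (b * a * a ^ 2) ≤ a / 1000 * (b * a * a ^ 2) := by
        gcongr
        linarith
      have h3 : 0 ≤ b * a ^ 4 := by positivity
      linarith
    exact_mod_cast this
  · intro hk
    have : (20 : ℝ) * q ^ k ≤ m := by
      have h1 : (q : ℝ) ^ k ≤ (a / 1000) ^ k := by gcongr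
      rw [div_pow, ← hb] at h1
      have h2 : (1000 : ℝ) ^ 1 ≤ 1000 ^ k := pow_le_pow_right₀ (by norm_num) hk
      have h3 : b / 1000 ^ k ≤ b / 1000 := by
        gcongr
        linarith
      linarith
    exact_mod_cast this
  · intro hk
    rw [Nat.le_sub_iff_add_le hql.le]
    have : (40 : ℝ) * q * (q + 1) + q ≤ (2 * l : ℕ) := by
      refine le_trans ?_ hl2
      have h1 : a ^ 1 ≤ b := pow_le_pow_right₀ ha1 hk
      have h2 : (q : ℝ) * (q + 1) ≤ a / 1000 * (a / 1000) := by
        gcongr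
        linarith
      have h3 : a * a ≤ b * a := by gcongr; linarith
      linarith
    exact_mod_cast this

end Numbers

/-! ### The three lower bounds -/

section Main

/-- If the conditions which depend on the allowed queries can be satisfied, then the number of
queries is at least of the order `n ^ (1 / (k + 3))`. -/
theorem requiresQueries_of_frame {allowed : ∀ V : Type, Set (Query V)} (k : ℕ)
    (wide : Prop) (lam : ℕ → ℕ → ℝ)
    (hfresh : ∀ {V I L : Type} [Fintype V] [Fintype I] [Fintype L] (F : Frame V I L) (q : ℕ),
      q < Fintype.card L → ∀ h, Reachable (allowed V) q h → F.Valid wide h →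
        ∑ i, (1 - F.freshRatio wide h i) ≤ lam q (Fintype.card L))
    (hlam : ∀ s l q : ℕ, 200 * (q + 1) ^ 2 ≤ s → q < l → (1 ≤ k → 40 * q * (q + 1) ≤ l - q) →
      40 * (1 + lam q l) * (q + 1) ≤ s)
    (hfull : ∀ {V : Type} (x : V), Query.fullNbrHood x ∈ allowed V → ∀ l q : ℕ, q < l →
      (1 ≤ k → 40 * q * (q + 1) ≤ l - q) → 20 * lam q l * (q + 1) ≤ 1)
    (hC : ∀ {V I L : Type} [Fintype V] [Fintype I] [Fintype L] (F : Frame V I L) (q m : ℕ)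
      (h : History V), Reachable (allowed V) q h → F.Valid wide h →
      (1 ≤ k → 20 * q ^ k ≤ m) → ∃ C, F.Conflicts h C ∧ 20 * C.card ≤ m) :
    RequiresQueries allowed (1 / (k + 3 : ℕ)) := by
  intro c hc
  obtain ⟨K, hK⟩ := exists_nat_ge (2 * c ^ 2)
  have hK1R : (1 : ℝ) ≤ K := by nlinarith
  have hK1 : 1 ≤ K := by exact_mod_cast hK1R
  -- The threshold for `n` gives `a ≥ 2000 * K`, so `q < a / (2000 * K)` leaves room for the `+ 1`
  -- in `(q + 1) * 1000 * K ≤ a`.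
  refine ⟨1 / (2000 * K), by positivity, (2000 * K) ^ (k + 3), ?_⟩
  intro n hn A q hA
  set a : ℝ := (n : ℝ) ^ (1 / ((k + 3 : ℕ) : ℝ)) with ha
  have hak : a ^ (k + 3) = n := by
    rw [ha, ← Real.rpow_natCast, ← Real.rpow_mul (Nat.cast_nonneg n), one_div,
      inv_mul_cancel₀ (by positivity), Real.rpow_one]
  have ha0 : 0 ≤ a := Real.rpow_nonneg (Nat.cast_nonneg n) _
  have haK : 2000 * (K : ℝ) ≤ a := by
    refine le_of_pow_le_pow_left₀ (n := k + 3) (by omega) ha0 ?_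
    rw [hak]
    exact_mod_cast hn
  by_contra hlt
  push Not at hlt
  have hq : ((q : ℝ) + 1) * (1000 * K) ≤ a := by
    rw [div_mul_eq_mul_div, one_mul, lt_div_iff₀ (by positivity)] at hlt
    linarith
  obtain ⟨s, l, m, hs, hsl, hql, hqs, hKm, hqKm, hnm, hqm, hqq⟩ :=
    exists_sizes hak hK1 (by linarith) hq
  have hn2 : 2 ≤ n := by nlinarith
  let F := frame hn2 hsl
  refine F.not_estimates (q := q) (m := m) (K := K) (lam := lam q (2 * l)) (wide := wide) hc hK
    (by simpa using hs) (by simpa using hql) ?_ ?_ ?_ ?_ (by simpa using hKm) (by simpa using hqKm)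
    (by simpa using hnm) (by simp; omega) hA
  · intro h hr hh
    have := hfresh F q (by simpa using hql) h hr hh
    simpa using this
  · simpa using hlam s (2 * l) q hqs hql hqq
  · intro x hx
    exact hfull x hx _ _ hql hqq
  · intro h hr hh
    exact hC F q m h hr hh hqm

lemma not_fullNbrHood_of_base {V : Type} {u : Query V} (hu : u ∈ baseQueries V) (x : V) :
    u ≠ .fullNbrHood x := by
  rintro rfl
  simp [baseQueries] at hu

lemma not_pair_of_base {V : Type} {u : Query V} (hu : u ∈ baseQueries V) (x y : V) :
    u ≠ .pair x y := by
  rintro rfl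
  simp [baseQueries] at hu

lemma not_fullNbrHood_of_pair {V : Type} {u : Query V} (hu : u ∈ pairQueries V) (x : V) :
    u ≠ .fullNbrHood x := by
  rcases hu with hu | ⟨y, z, rfl⟩
  · exact not_fullNbrHood_of_base hu x
  · simp

lemma wide_lam_bound {s q : ℕ} (hq : 200 * (q + 1) ^ 2 ≤ s) :
    40 * (1 + 4 * (q : ℝ)) * (q + 1) ≤ s := by
  have h1 : (200 : ℝ) * (q + 1) ^ 2 ≤ s := by exact_mod_cast hq
  have h2 : (0 : ℝ) ≤ q := Nat.cast_nonneg q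
  nlinarith

lemma narrow_lam_bound {l q : ℕ} (hql : q < l) (hq : 40 * q * (q + 1) ≤ l - q) :
    20 * (2 * (q : ℝ) / (l - q : ℕ)) * (q + 1) ≤ 1 := by
  have hpos : (0 : ℝ) < (l - q : ℕ) := by exact_mod_cast Nat.sub_pos_of_lt hql
  rw [mul_div_assoc', div_mul_eq_mul_div, div_le_one hpos]
  have : (40 : ℝ) * q * (q + 1) ≤ (l - q : ℕ) := by exact_mod_cast hq
  linarith

/-- There are no conflicts at all, so `k = 0` is possible: one clique against `K` cliques. -/
theorem requiresQueries_base : RequiresQueries baseQueries (1 / 3) := by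
  have h := requiresQueries_of_frame (allowed := baseQueries) 0 True (fun q _ => 4 * q)
    (fun F q hq h hr _ => Frame.sum_one_sub_freshRatio_le_of_wide (by omega)
      (fun p hp => not_fullNbrHood_of_base (hr.2 p hp)) hr.1)
    (fun s l q hs _ _ => wide_lam_bound hs)
    (fun x hx => absurd rfl (not_fullNbrHood_of_base hx x))
    (fun F q m h hr hh _ => ⟨∅, Frame.conflicts_empty_of_wide hh
      (fun p hp => not_pair_of_base (hr.2 p hp)), by simp⟩)
  simpa using h

/-- At most `q` conflicts occur, so `m` of order `q` suffices and `k = 1`. -/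
theorem requiresQueries_pair : RequiresQueries pairQueries (1 / 4) := by
  have h := requiresQueries_of_frame (allowed := pairQueries) 1 True (fun q _ => 4 * q)
    (fun F q hq h hr _ => Frame.sum_one_sub_freshRatio_le_of_wide (by omega)
      (fun p hp => not_fullNbrHood_of_pair (hr.2 p hp)) hr.1)
    (fun s l q hs _ _ => wide_lam_bound hs)
    (fun x hx => absurd rfl (not_fullNbrHood_of_pair hx x))
    (fun F q m h hr hh hqm => by
      obtain ⟨C, hC, hCcard⟩ := Frame.exists_conflicts_of_wide hh
      have h1 := hqm le_rfl
      rw [pow_one] at h1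
      have h2 := hr.1
      exact ⟨C, hC, by omega⟩)
  norm_num at h
  norm_num
  exact h

/-- One full neighbourhood touches every block, so the narrow process is needed; up to `q ^ 2`
conflicts lead to `k = 2`. -/
theorem requiresQueries_full : RequiresQueries fullQueries (1 / 5) := by
  have h := requiresQueries_of_frame (allowed := fullQueries) 2 False
    (fun q l => 2 * q / (l - q : ℕ))
    (fun F q hq h hr hh => Frame.sum_one_sub_freshRatio_le hh hr.1 hq)
    (fun s l q hs hql hq => by
      have h1 := narrow_lam_bound hql (hq (by norm_num))
      have h2 : (200 : ℝ) * (q + 1) ^ 2 ≤ s := by exact_mod_cast hs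
      have h3 : (0 : ℝ) ≤ q := Nat.cast_nonneg q
      nlinarith)
    (fun x _ l q hql hq => narrow_lam_bound hql (hq (by norm_num)))
    (fun F q m h hr hh hqm => by
      obtain ⟨C, hC, hCcard⟩ := Frame.exists_conflicts (F := F) hr.1
      have h1 := hqm (by norm_num)
      exact ⟨C, hC, by omega⟩)
  norm_num at h
  norm_num
  exact h

end Main

end AvgDegree

theorem theorem5p1 :
    AvgDegree.RequiresQueries AvgDegree.baseQueries (1 / 3) ∧
    AvgDegree.RequiresQueries AvgDegree.pairQueries (1 / 4) ∧
    AvgDegree.RequiresQueries AvgDegree.fullQueries (1 / 5) :=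
  ⟨AvgDegree.requiresQueries_base, AvgDegree.requiresQueries_pair,
    AvgDegree.requiresQueries_full⟩
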